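/- Let $-\infty\le\alpha<\beta\le\infty$ and $U=\{s\in\mathbb{C}:\alpha<\operatorname{Re}s<\beta\}$. Let $f$ be almost periodic in $U$, that is, $f$ is analytic in $U$ and, for all real $a,b$ with $\alpha<a\le b<\beta$ and every $\varepsilon>0$, there is $l>0$ such that every open interval of length $l$ contains a number $\tau$ with $|f(s+i\tau)-f(s)|\le\varepsilon$ for all $s$ with $a\le\operatorname{Re}s\le b$. The Fourier exponents of $f$ are the real numbers $\lambda$ for which there is $c_\lambda\neq 0$ such that, for every $\sigma\in(\alpha,\beta)$, $$\lim_{T\to\infty}\frac1{2T}\int_{-T}^{T}f(\sigma+it)\,e^{-\lambda(\sigma+it)}\,dt=c_\lambda .$$ Suppose that the Fourier exponents of $f$ are linearly independent over $\mathbb{Q}$ and that there are at least three of them (possibly infinitely many). Then the set $$Z_f=\{\operatorname{Re}s: s\in U,\ f(s)=0\}$$ has no isolated point: every point of $Z_f$ is an accumulation point of $Z_f$. Moreover, the set $R_f=\overline{Z_f}\cap(\alpha,\beta)$ is the union of an at most countable (possibly empty) family of pairwise disjoint nondegenerate intervals. -/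

import Mathlib

open Filter Topology

/-- The open interval `(α, β)` of real numbers; the endpoints may be infinite. -/
def realInterval (α β : EReal) : Set ℝ :=
  {σ : ℝ | α < (σ : EReal) ∧ (σ : EReal) < β}

/-- The open vertical strip `{s ∈ ℂ : α < Re s < β}`, `-∞ ≤ α < β ≤ ∞`. -/
def verticalStrip (α β : EReal) : Set ℂ :=
  {s : ℂ | s.re ∈ realInterval α β}

/-- `f` is (analytic) almost periodic in the open vertical strip `α < Re s < β`:
it is analytic there, and on every reduced strip `a ≤ Re s ≤ b` with `α < a`, `b < β`, for every
`ε > 0` there is a length `l` such that each open interval of length `l` contains a number `τ` with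
`|f(s + iτ) - f(s)| ≤ ε` on the whole reduced strip. -/
def IsAlmostPeriodicInStrip (f : ℂ → ℂ) (α β : EReal) : Prop :=
  DifferentiableOn ℂ f (verticalStrip α β) ∧
    ∀ a b : ℝ, α < (a : EReal) → (b : EReal) < β →
      ∀ ε : ℝ, 0 < ε → ∃ l : ℝ, 0 < l ∧ ∀ t₀ : ℝ, ∃ τ ∈ Set.Ioo t₀ (t₀ + l),
        ∀ s : ℂ, a ≤ s.re → s.re ≤ b → ‖f (s + Complex.I * (τ : ℂ)) - f s‖ ≤ ε

/-- `c` is the coefficient of `e ^ (lam * s)` in the Dirichlet (Fourier) series of `f` in the strip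
`α < Re s < β`: for every `σ ∈ (α, β)`, `c` is the mean value
`lim_{T → ∞} (1 / 2T) ∫_{-T}^{T} f(σ + it) e^{- lam (σ + it)} dt`. -/
def IsDirichletCoeff (f : ℂ → ℂ) (α β : EReal) (lam : ℝ) (c : ℂ) : Prop :=
  ∀ σ ∈ realInterval α β,
    Tendsto
      (fun T : ℝ => (1 / (2 * (T : ℂ))) *
        ∫ t in (-T)..T, f ((σ : ℂ) + Complex.I * (t : ℂ)) *
          Complex.exp (-((lam : ℂ) * ((σ : ℂ) + Complex.I * (t : ℂ)))))
      atTop (𝓝 c)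

/-- The set of Fourier exponents of `f` in the strip `α < Re s < β`: the real numbers that occur in
the Dirichlet series of `f` with a nonzero coefficient. -/
def fourierExponents (f : ℂ → ℂ) (α β : EReal) : Set ℝ :=
  {lam : ℝ | ∃ c : ℂ, c ≠ 0 ∧ IsDirichletCoeff f α β lam c}

/-- The real projections of the zeros: `{Re s : f(s) = 0, s ∈ U}`, `U` the strip. -/
def zeroRealParts (f : ℂ → ℂ) (α β : EReal) : Set ℝ :=
  Complex.re '' {s : ℂ | s ∈ verticalStrip α β ∧ f s = 0}

/-- The set `R_f`: the closure of the set of real projections of the zeros, intersected with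
`(α, β)`. -/
def closedZeroRealParts (f : ℂ → ℂ) (α β : EReal) : Set ℝ :=
  closure (zeroRealParts f α β) ∩ realInterval α β

/-! Linear independence makes the Fourier series absolutely convergent. On a vertical line, test `f`
against a nonnegative kernel `|Q|²`, where `Q` is a trigonometric polynomial whose phases are chosen
to turn every coefficient into its modulus. This gives Bohr's inequality `sum_norm_coeff_le`. A
uniqueness theorem (`IsAP.eq_zero_of_means`) identifies the resulting sum with the function, and
Cauchy's theorem makes the coefficients independent of the line. Hence `f s = ∑ c x e^{x s}`
throughout the strip. Series are indexed by all real `x`, with `c x = 0` off the exponents.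

With this, `R_f` is described by moduli alone (`mem_closedZeroRealParts_iff`): `σ` lies in `R_f`
exactly when no term `|c y| e^{y σ}` exceeds the sum of the others. A dominant term excludes zeros
nearby by the triangle inequality. If there is none, the moduli are the sides of a closed polygon,
so some rotation of the coefficients gives a series vanishing at `σ`. By Kronecker's theorem
vertical translates of `f` approximate the rotated series, and a Hurwitz argument moves the zero to
`f`, with real part close to `σ`.

The rest is convexity. Dividing by `e^{y σ}` shows that each term dominates on a convex set of
abscissas. Suppose dominated abscissas accumulate at a point of `R_f` from both sides. One term
dominating on both sides would dominate at the point itself. Two different terms would each carry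
half of the total there, leaving nothing for a third exponent. So every point of `R_f` has a
one-sided neighbourhood inside `R_f` (`eventually_or_eventually_not_dominant`), and both conclusions
follow. -/

/-! ### Oscillations and almost periodic functions on the line. -/

/-- The oscillation `t ↦ e ^ (i μ t)`. -/
noncomputable def osc (μ t : ℝ) : ℂ := Complex.exp (((μ * t : ℝ) : ℂ) * Complex.I)

@[simp] lemma norm_osc (μ t : ℝ) : ‖osc μ t‖ = 1 := Complex.norm_exp_ofReal_mul_I _

@[fun_prop] lemma continuous_osc (μ : ℝ) : Continuous (osc μ) := by
  unfold osc; fun_prop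

@[simp] lemma osc_zero_left (t : ℝ) : osc 0 t = 1 := by simp [osc]

@[simp] lemma osc_zero_right (μ : ℝ) : osc μ 0 = 1 := by simp [osc]

lemma osc_add_left (μ ν t : ℝ) : osc (μ + ν) t = osc μ t * osc ν t := by
  rw [osc, osc, osc, ← Complex.exp_add]; push_cast; ring_nf

lemma osc_add_right (μ t u : ℝ) : osc μ (t + u) = osc μ t * osc μ u := by
  rw [osc, osc, osc, ← Complex.exp_add]; push_cast; ring_nf

lemma conj_osc (μ t : ℝ) : (starRingEnd ℂ) (osc μ t) = osc (-μ) t := by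
  rw [osc, osc, ← Complex.exp_conj]; simp

lemma norm_osc_sub_osc_le (μ t u : ℝ) : ‖osc μ t - osc μ u‖ ≤ |μ| * |t - u| := by
  have h : osc μ t - osc μ u = osc μ u * (osc μ (t - u) - 1) := by
    rw [mul_sub, ← osc_add_right]; simp
  rw [h, norm_mul, norm_osc, one_mul, osc, mul_comm _ Complex.I]
  exact (Real.norm_exp_I_mul_ofReal_sub_one_le).trans (by rw [Real.norm_eq_abs, abs_mul])

/-- Almost periodicity on the line by total boundedness of the set of translates: for each `ε` the
translation parameters can be coloured with finitely many colours so that translates by parameters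
of the same colour are uniformly `ε`-close. -/
def IsAP (F : ℝ → ℂ) : Prop :=
  Continuous F ∧ ∀ ε : ℝ, 0 < ε → ∃ (n : ℕ) (col : ℝ → Fin n),
    ∀ x y, col x = col y → ∀ t, ‖F (x + t) - F (y + t)‖ ≤ ε

/-- Almost periodicity in the sense of Bohr: almost periods are relatively dense. -/
def IsBohrAP (F : ℝ → ℂ) : Prop :=
  ∀ ε : ℝ, 0 < ε → ∃ l : ℝ, 0 < l ∧ ∀ t₀ : ℝ, ∃ τ ∈ Set.Ioo t₀ (t₀ + l),
    ∀ t, ‖F (t + τ) - F t‖ ≤ ε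

/-- Fix one representative of each colour in use. The difference between `x` and the representative
of its colour is an almost period, and the representatives are bounded, so such differences are
relatively dense. -/
lemma IsAP.isBohrAP {F : ℝ → ℂ} (hF : IsAP F) : IsBohrAP F := by
  intro ε hε
  obtain ⟨n, col, hcol⟩ := hF.2 ε hε
  classical
  let rep : Fin n → ℝ := fun i => if h : ∃ x, col x = i then h.choose else 0
  have hrep : ∀ x, col (rep (col x)) = col x := by
    intro x
    have h : ∃ y, col y = col x := ⟨x, rfl⟩
    simp only [rep, dif_pos h]
    exact h.choose_spec
  obtain ⟨L, hL⟩ : ∃ L, ∀ i, |rep i| ≤ L := by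
    refine ⟨∑ i, |rep i|, fun i => ?_⟩
    exact Finset.single_le_sum (f := fun i => |rep i|) (fun _ _ => abs_nonneg _) (Finset.mem_univ i)
  have hL0 : 0 ≤ L := (abs_nonneg _).trans (hL (col 0))
  refine ⟨2 * L + 2, by linarith, fun t₀ => ?_⟩
  set x := t₀ + L + 1 with hx
  refine ⟨x - rep (col x), ?_, fun t => ?_⟩
  · have := abs_le.1 (hL (col x))
    constructor <;> linarith
  · have := hcol x (rep (col x)) (hrep x).symm (t - rep (col x))
    convert this using 3 <;> ring_nf

lemma IsBohrAP.exists_norm_le {F : ℝ → ℂ} (hF : IsBohrAP F) (hc : Continuous F) :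
    ∃ C, 0 < C ∧ ∀ t, ‖F t‖ ≤ C := by
  obtain ⟨l, hl, h⟩ := hF 1 one_pos
  obtain ⟨C, hC⟩ := (isCompact_Icc (a := (0 : ℝ)) (b := l)).exists_bound_of_continuousOn
    hc.continuousOn
  refine ⟨|C| + 1, by positivity, fun t => ?_⟩
  obtain ⟨τ, hτ, hh⟩ := h (-t)
  have h1 := hC (t + τ) ⟨by linarith [hτ.1], by linarith [hτ.2]⟩
  have h2 := hh t
  rw [norm_sub_rev] at h2
  have h3 := norm_le_norm_add_norm_sub' (F t) (F (t + τ))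
  linarith [le_abs_self C]

lemma IsBohrAP.uniformContinuous {F : ℝ → ℂ} (hF : IsBohrAP F) (hc : Continuous F) :
    ∀ ε : ℝ, 0 < ε → ∃ δ : ℝ, 0 < δ ∧ ∀ x y, |x - y| ≤ δ → ‖F x - F y‖ ≤ ε := by
  intro ε hε
  obtain ⟨l, hl, h⟩ := hF (ε / 3) (by positivity)
  have huc := (isCompact_Icc (a := (-1 : ℝ)) (b := l + 1)).uniformContinuousOn_of_continuous
    hc.continuousOn
  rw [Metric.uniformContinuousOn_iff] at huc
  obtain ⟨δ, hδ, hd⟩ := huc (ε / 3) (by positivity)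
  refine ⟨min (δ / 2) 1, by positivity, fun x y hxy => ?_⟩
  obtain ⟨τ, hτ, hh⟩ := h (-x)
  have hxy1 := abs_le.1 (hxy.trans (min_le_right _ _))
  have hxy2 := hxy.trans (min_le_left _ _)
  have h1 := hd (x + τ) ⟨by linarith [hτ.1], by linarith [hτ.2]⟩ (y + τ)
    ⟨by linarith [hτ.1], by linarith [hτ.2]⟩
    (by rw [Real.dist_eq, add_sub_add_right_eq_sub]; linarith)
  rw [dist_eq_norm] at h1
  have h2 := hh x
  have h3 := hh y
  have e : F x - F y = -(F (x + τ) - F x) + (F (x + τ) - F (y + τ)) + (F (y + τ) - F y) := by ring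
  rw [e]
  refine (norm_add₃_le).trans ?_
  rw [norm_neg]; linarith

/-- Subtracting an almost period `τ x ∈ (x - l, x)` moves the parameter into `(0, l)`. The colour is
the cell of length `δ` containing `x - τ x`, with `δ` taken from uniform continuity. -/
lemma IsBohrAP.isAP {F : ℝ → ℂ} (hF : IsBohrAP F) (hc : Continuous F) : IsAP F := by
  refine ⟨hc, fun ε hε => ?_⟩
  obtain ⟨l, hl, h⟩ := hF (ε / 3) (by positivity)
  obtain ⟨δ, hδ, hd⟩ := hF.uniformContinuous hc (ε / 3) (by positivity)
  choose τ hτ hh using fun x => h (x - l)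
  let k : ℝ → ℕ := fun x => ⌊(x - τ x) / δ⌋₊
  have hk : ∀ x, k x < ⌊l / δ⌋₊ + 1 := by
    intro x
    refine Nat.lt_succ_of_le (Nat.floor_le_floor ?_)
    have := (hτ x).1
    gcongr; linarith
  refine ⟨⌊l / δ⌋₊ + 1, fun x => ⟨k x, hk x⟩, fun x y hxy t => ?_⟩
  have hkk : k x = k y := by simpa using hxy
  have hpos : ∀ z, 0 ≤ (z - τ z) / δ := fun z => by
    have := (hτ z).2
    apply div_nonneg _ hδ.le; linarith
  have hclose : |(x - τ x) - (y - τ y)| ≤ δ := by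
    have hx1 := Nat.floor_le (hpos x)
    have hx2 := Nat.lt_floor_add_one ((x - τ x) / δ)
    have hy1 := Nat.floor_le (hpos y)
    have hy2 := Nat.lt_floor_add_one ((y - τ y) / δ)
    change ((k x : ℕ) : ℝ) ≤ _ at hx1
    change _ < ((k x : ℕ) : ℝ) + 1 at hx2
    change ((k y : ℕ) : ℝ) ≤ _ at hy1
    change _ < ((k y : ℕ) : ℝ) + 1 at hy2
    rw [hkk] at hx1 hx2
    rw [le_div_iff₀ hδ] at hx1 hy1
    rw [div_lt_iff₀ hδ] at hx2 hy2
    rw [abs_le]; constructor <;> nlinarith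
  have h1 := hh x (x - τ x + t)
  have h2 := hh y (y - τ y + t)
  have h3 := hd (x - τ x + t) (y - τ y + t) (by rwa [add_sub_add_right_eq_sub])
  rw [show x - τ x + t + τ x = x + t by ring] at h1
  rw [show y - τ y + t + τ y = y + t by ring] at h2
  have e : F (x + t) - F (y + t) = (F (x + t) - F (x - τ x + t)) +
    (F (x - τ x + t) - F (y - τ y + t)) + -(F (y + t) - F (y - τ y + t)) := by ring
  rw [e]
  refine (norm_add₃_le).trans ?_
  rw [norm_neg]; linarith

lemma IsAP.exists_norm_le {F : ℝ → ℂ} (hF : IsAP F) : ∃ C, 0 < C ∧ ∀ t, ‖F t‖ ≤ C :=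
  hF.isBohrAP.exists_norm_le hF.1

/-- Pairs of colours serve both functions at once. This is the advantage of colourings over almost
periods, for which a common supply is not immediate, and it yields closure under sums and products.
-/
lemma IsAP.exists_common_coloring {F G : ℝ → ℂ} (hF : IsAP F) (hG : IsAP G) {ε : ℝ} (hε : 0 < ε) :
    ∃ (n : ℕ) (col : ℝ → Fin n), ∀ x y, col x = col y → ∀ t,
      ‖F (x + t) - F (y + t)‖ ≤ ε ∧ ‖G (x + t) - G (y + t)‖ ≤ ε := by
  obtain ⟨n, col, h⟩ := hF.2 ε hε
  obtain ⟨m, col', h'⟩ := hG.2 ε hε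
  refine ⟨n * m, fun x => finProdFinEquiv (col x, col' x), fun x y hxy t => ?_⟩
  have := Prod.mk.injEq .. ▸ finProdFinEquiv.injective hxy
  exact ⟨h x y this.1 t, h' x y this.2 t⟩

lemma IsAP.add {F G : ℝ → ℂ} (hF : IsAP F) (hG : IsAP G) : IsAP (fun t => F t + G t) := by
  refine ⟨hF.1.add hG.1, fun ε hε => ?_⟩
  obtain ⟨n, col, h⟩ := hF.exists_common_coloring hG (half_pos hε)
  refine ⟨n, col, fun x y hxy t => ?_⟩
  obtain ⟨h1, h2⟩ := h x y hxy t
  rw [add_sub_add_comm]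
  exact (norm_add_le _ _).trans (by linarith)

lemma IsAP.mul {F G : ℝ → ℂ} (hF : IsAP F) (hG : IsAP G) : IsAP (fun t => F t * G t) := by
  refine ⟨hF.1.mul hG.1, fun ε hε => ?_⟩
  obtain ⟨C, hC, hFC⟩ := hF.exists_norm_le
  obtain ⟨D, hD, hGD⟩ := hG.exists_norm_le
  obtain ⟨n, col, h⟩ := hF.exists_common_coloring hG (ε := ε / (C + D)) (by positivity)
  refine ⟨n, col, fun x y hxy t => ?_⟩
  obtain ⟨h1, h2⟩ := h x y hxy t
  have e : F (x + t) * G (x + t) - F (y + t) * G (y + t) =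
    F (x + t) * (G (x + t) - G (y + t)) + (F (x + t) - F (y + t)) * G (y + t) := by ring
  rw [e]
  refine (norm_add_le _ _).trans ?_
  rw [norm_mul, norm_mul]
  calc _ ≤ C * (ε / (C + D)) + ε / (C + D) * D := by
        gcongr
        · exact hFC _
        · exact hGD _
    _ = ε := by field_simp

lemma isAP_const (c : ℂ) : IsAP (fun _ => c) :=
  ⟨continuous_const, fun ε hε => ⟨1, fun _ => 0, fun x y _ t => by simpa using hε.le⟩⟩

lemma isAP_osc (μ : ℝ) : IsAP (osc μ) := by
  refine IsBohrAP.isAP (fun ε hε => ?_) (continuous_osc μ)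
  rcases eq_or_ne μ 0 with rfl | hμ
  · exact ⟨1, one_pos, fun t₀ => ⟨t₀ + 1 / 2, ⟨by linarith, by linarith⟩, fun t => by simpa using hε.le⟩⟩
  · set p := 2 * Real.pi / |μ| with hp
    have hp0 : 0 < p := by have := Real.pi_pos; positivity
    refine ⟨2 * p, by positivity, fun t₀ => ⟨(⌊t₀ / p⌋ + 1 : ℤ) * p, ⟨?_, ?_⟩, fun t => ?_⟩⟩
    · have := Int.lt_floor_add_one (t₀ / p)
      rw [div_lt_iff₀ hp0] at this
      push_cast; exact this
    · have := Int.floor_le (t₀ / p)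
      rw [le_div_iff₀ hp0] at this
      push_cast; linarith
    · have key : osc μ ((⌊t₀ / p⌋ + 1 : ℤ) * p) = 1 := by
        rw [osc, Complex.exp_eq_one_iff]
        rcases abs_cases μ with ⟨h, _⟩ | ⟨h, _⟩
        · refine ⟨⌊t₀ / p⌋ + 1, ?_⟩
          rw [hp, h]
          have : (μ : ℂ) ≠ 0 := by exact_mod_cast hμ
          push_cast; field_simp
        · refine ⟨-(⌊t₀ / p⌋ + 1), ?_⟩
          rw [hp, h]
          have : (μ : ℂ) ≠ 0 := by exact_mod_cast hμ
          push_cast; field_simp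
      rw [osc_add_right, key]; simpa using hε.le

lemma IsAP.const_mul {F : ℝ → ℂ} (hF : IsAP F) (c : ℂ) : IsAP (fun t => c * F t) :=
  (isAP_const c).mul hF

lemma IsAP.sub {F G : ℝ → ℂ} (hF : IsAP F) (hG : IsAP G) : IsAP (fun t => F t - G t) := by
  simpa [sub_eq_add_neg] using hF.add (hG.const_mul (-1))

lemma IsAP.finset_sum {ι : Type*} {F : ι → ℝ → ℂ} (s : Finset ι) (h : ∀ i ∈ s, IsAP (F i)) :
    IsAP (fun t => ∑ i ∈ s, F i t) := by
  classical
  induction s using Finset.induction_on with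
  | empty => simpa using isAP_const 0
  | insert i s hi ih =>
    simp only [Finset.sum_insert hi]
    exact (h i (by simp)).add (ih fun j hj => h j (by simp [hj]))

lemma IsAP.of_uniform_approx {F : ℝ → ℂ}
    (h : ∀ ε : ℝ, 0 < ε → ∃ G, IsAP G ∧ ∀ t, ‖F t - G t‖ ≤ ε) : IsAP F := by
  have hc : Continuous F := by
    refine continuous_of_uniform_approx_of_continuous fun u hu => ?_
    obtain ⟨ε, hε, hεu⟩ := Metric.mem_uniformity_dist.1 hu
    obtain ⟨G, hG, hFG⟩ := h (ε / 2) (half_pos hε)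
    refine ⟨G, hG.1, fun t => hεu ?_⟩
    rw [dist_eq_norm]; linarith [hFG t]
  refine ⟨hc, fun ε hε => ?_⟩
  obtain ⟨G, hG, hFG⟩ := h (ε / 3) (by positivity)
  obtain ⟨n, col, hcol⟩ := hG.2 (ε / 3) (by positivity)
  refine ⟨n, col, fun x y hxy t => ?_⟩
  have e : F (x + t) - F (y + t) = (F (x + t) - G (x + t)) + (G (x + t) - G (y + t)) +
    -(F (y + t) - G (y + t)) := by ring
  rw [e]
  refine (norm_add₃_le).trans ?_
  rw [norm_neg]; linarith [hFG (x + t), hFG (y + t), hcol x y hxy t]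

lemma IsAP.comp_add_right {F : ℝ → ℂ} (hF : IsAP F) (a : ℝ) : IsAP (fun t => F (t + a)) := by
  refine ⟨hF.1.comp (continuous_id.add continuous_const), fun ε hε => ?_⟩
  obtain ⟨n, col, h⟩ := hF.2 ε hε
  exact ⟨n, col, fun x y hxy t => by simpa [add_assoc] using h x y hxy (t + a)⟩

/-! ### Mean values. -/

/-- `m` is the mean value of the continuous function `F`, uniformly over all translates. -/
def HasUMean (F : ℝ → ℂ) (m : ℂ) : Prop :=
  Continuous F ∧ ∀ ε : ℝ, 0 < ε → ∃ T₀ : ℝ, 0 < T₀ ∧ ∀ T, T₀ ≤ T → ∀ a,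
    ‖(∫ t in a..(a + T), F t) - T * m‖ ≤ ε * T

/-- Move the starting point from `a` to an almost period `τ ∈ (a, a + l)`. The two end pieces cost
at most `C * l` each, and translation by `τ` costs `ε * T`. -/
lemma IsAP.norm_integral_sub_integral_le {F : ℝ → ℂ} (hF : IsAP F) :
    ∀ ε : ℝ, 0 < ε → ∃ D : ℝ, 0 < D ∧ ∀ T, 0 ≤ T → ∀ a,
      ‖(∫ t in a..(a + T), F t) - ∫ t in (0 : ℝ)..T, F t‖ ≤ ε * T + D := by
  intro ε hε
  obtain ⟨C, hC, hFC⟩ := hF.exists_norm_le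
  obtain ⟨l, hl, h⟩ := hF.isBohrAP ε hε
  refine ⟨2 * C * l, by positivity, fun T hT a => ?_⟩
  obtain ⟨τ, hτ, hh⟩ := h a
  have hi : ∀ x y : ℝ, IntervalIntegrable F MeasureTheory.volume x y :=
    fun x y => hF.1.intervalIntegrable x y
  have e1 : (∫ t in a..(a + T), F t) = (∫ t in a..τ, F t) + (∫ t in τ..(τ + T), F t) -
      ∫ t in (a + T)..(τ + T), F t := by
    rw [intervalIntegral.integral_add_adjacent_intervals (hi _ _) (hi _ _),
      intervalIntegral.integral_interval_sub_interval_comm' (hi _ _) (hi _ _) (hi _ _)]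
    simpa using intervalIntegral.integral_symm _ _
  have e2 : (∫ t in τ..(τ + T), F t) = ∫ t in (0 : ℝ)..T, F (t + τ) := by
    rw [intervalIntegral.integral_comp_add_right]; simp [add_comm]
  have hi' : IntervalIntegrable (fun t => F (t + τ)) MeasureTheory.volume 0 T :=
    (hF.1.comp (continuous_id.add continuous_const)).intervalIntegrable _ _
  have e3 : (∫ t in (0 : ℝ)..T, F (t + τ)) - (∫ t in (0 : ℝ)..T, F t) =
      ∫ t in (0 : ℝ)..T, (F (t + τ) - F t) := by
    rw [intervalIntegral.integral_sub hi' (hi _ _)]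
  have b1 : ‖∫ t in a..τ, F t‖ ≤ C * l := by
    refine (intervalIntegral.norm_integral_le_of_norm_le_const fun t _ => hFC t).trans ?_
    rw [abs_of_pos (by linarith [hτ.1])]
    gcongr; linarith [hτ.2]
  have b2 : ‖∫ t in (a + T)..(τ + T), F t‖ ≤ C * l := by
    refine (intervalIntegral.norm_integral_le_of_norm_le_const fun t _ => hFC t).trans ?_
    rw [abs_of_pos (by linarith [hτ.1])]
    gcongr; linarith [hτ.2]
  have b3 : ‖∫ t in (0 : ℝ)..T, (F (t + τ) - F t)‖ ≤ ε * T := by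
    refine (intervalIntegral.norm_integral_le_of_norm_le_const fun t _ => hh t).trans ?_
    rw [sub_zero, abs_of_nonneg hT]
  have e : (∫ t in a..(a + T), F t) - (∫ t in (0 : ℝ)..T, F t) = (∫ t in a..τ, F t) +
      (∫ t in (0 : ℝ)..T, (F (t + τ) - F t)) + -∫ t in (a + T)..(τ + T), F t := by
    rw [e1, e2, ← e3]; ring
  rw [e]
  refine norm_add₃_le.trans ?_
  rw [norm_neg]; linarith

/-- The double integral of `F (a + t)` over `[0, S] × [0, T]` is close both to `S` times the
integral up to `T` and, by Fubini, to `T` times the integral up to `S`. Dividing by `S * T` compares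
averages over different lengths. -/
lemma IsAP.norm_mul_integral_sub_mul_integral_le {F : ℝ → ℂ} (hF : IsAP F) {ε D : ℝ}
    (h : ∀ T, 0 ≤ T → ∀ a,
      ‖(∫ t in a..(a + T), F t) - ∫ t in (0 : ℝ)..T, F t‖ ≤ ε * T + D)
    {T S : ℝ} (hT : 0 ≤ T) (hS : 0 ≤ S) :
    ‖S * (∫ t in (0 : ℝ)..T, F t) - T * (∫ t in (0 : ℝ)..S, F t)‖ ≤
      2 * ε * (T * S) + D * (T + S) := by
  have hc : Continuous (Function.uncurry fun a t : ℝ => F (a + t)) := by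
    have := hF.1; unfold Function.uncurry; fun_prop
  have hcc : ∀ T : ℝ, Continuous fun a : ℝ => ∫ t in (0 : ℝ)..T, F (a + t) := fun T =>
    intervalIntegral.continuous_parametric_intervalIntegral_of_continuous' hc 0 T
  have key : ∀ T S : ℝ, 0 ≤ T → 0 ≤ S → ‖(∫ a in (0 : ℝ)..S, ∫ t in (0 : ℝ)..T, F (a + t)) -
      S * ∫ t in (0 : ℝ)..T, F t‖ ≤ (ε * T + D) * S := by
    intro T S hT hS
    have e : (S : ℂ) * (∫ t in (0 : ℝ)..T, F t) =
        ∫ a in (0 : ℝ)..S, ∫ t in (0 : ℝ)..T, F t := by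
      simp
    rw [e, ← intervalIntegral.integral_sub ((hcc T).intervalIntegrable _ _)
      (continuous_const.intervalIntegrable _ _)]
    refine (intervalIntegral.norm_integral_le_of_norm_le_const (C := ε * T + D)
      fun a _ => ?_).trans ?_
    · have := h T hT a
      rwa [show (∫ t in (0 : ℝ)..T, F (a + t)) = ∫ t in a..(a + T), F t by
        rw [intervalIntegral.integral_comp_add_left]; simp]
    · rw [sub_zero, abs_of_nonneg hS]
  have hswap : (∫ a in (0 : ℝ)..S, ∫ t in (0 : ℝ)..T, F (a + t)) =
      ∫ a in (0 : ℝ)..T, ∫ t in (0 : ℝ)..S, F (a + t) := by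
    rw [MeasureTheory.intervalIntegral_intervalIntegral_swap]
    · simp only [add_comm]
    · refine (hc.continuousOn.integrableOn_compact
        ((isCompact_uIcc (a := (0 : ℝ)) (b := S)).prod
          (isCompact_uIcc (a := (0 : ℝ)) (b := T)))).mono_set ?_
      exact Set.prod_mono Set.uIoc_subset_uIcc Set.uIoc_subset_uIcc
  have k1 := key T S hT hS
  have k2 := key S T hS hT
  rw [← hswap] at k2
  set A := ∫ a in (0 : ℝ)..S, ∫ t in (0 : ℝ)..T, F (a + t)
  rw [show (S : ℂ) * (∫ t in (0 : ℝ)..T, F t) - T * (∫ t in (0 : ℝ)..S, F t) =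
    (A - T * (∫ t in (0 : ℝ)..S, F t)) - (A - S * (∫ t in (0 : ℝ)..T, F t)) by ring]
  refine (norm_sub_le _ _).trans ?_
  linarith

lemma IsAP.exists_hasUMean {F : ℝ → ℂ} (hF : IsAP F) : ∃ m, HasUMean F m := by
  set I : ℝ → ℂ := fun T => ∫ t in (0 : ℝ)..T, F t with hI
  have hcomp : ∀ ε : ℝ, 0 < ε → ∃ D : ℝ, 0 < D ∧
      (∀ T, 0 ≤ T → ∀ a, ‖(∫ t in a..(a + T), F t) - I T‖ ≤ ε * T + D) ∧
      ∀ T, 0 ≤ T → ∀ n : ℕ, 0 < n → ‖I T - T * (I n / n)‖ ≤ 2 * ε * T + D * (T / n + 1) := by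
    intro ε hε
    obtain ⟨D, hD, h⟩ := hF.norm_integral_sub_integral_le ε hε
    refine ⟨D, hD, h, fun T hT n hn => ?_⟩
    have h1 := hF.norm_mul_integral_sub_mul_integral_le h hT (Nat.cast_nonneg n)
    have hn' : (0 : ℝ) < n := by exact_mod_cast hn
    have hnc : (n : ℂ) ≠ 0 := by exact_mod_cast hn.ne'
    have e : I T - T * (I n / n) = (((n : ℝ) : ℂ) * I T - T * I n) / n := by
      push_cast; field_simp
    rw [e, norm_div, Complex.norm_natCast, div_le_iff₀ hn']
    refine h1.trans (le_of_eq ?_)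
    field_simp
  have hcauchy : CauchySeq fun n : ℕ => I n / n := by
    rw [Metric.cauchySeq_iff]
    intro ε hε
    obtain ⟨D, hD, -, h⟩ := hcomp (ε / 8) (by positivity)
    obtain ⟨N, hN⟩ := exists_nat_gt (max (8 * D / ε) 1)
    have hN1 : (1 : ℝ) < N := (le_max_right _ _).trans_lt hN
    have hN2 : 8 * D / ε < N := (le_max_left _ _).trans_lt hN
    refine ⟨N, fun m hm n hn => ?_⟩
    have hmR : (N : ℝ) ≤ m := by exact_mod_cast hm
    have hnR : (N : ℝ) ≤ n := by exact_mod_cast hn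
    have hm0 : (0 : ℝ) < m := by linarith
    have hn0 : (0 : ℝ) < n := by linarith
    have h1 := h m hm0.le n (by exact_mod_cast hn0)
    have hmc : (m : ℂ) ≠ 0 := by exact_mod_cast hm0.ne'
    rw [dist_eq_norm, show I m / m - I n / n = (I m - (m : ℝ) * (I n / n)) / m by
      push_cast; field_simp, norm_div, Complex.norm_natCast, div_lt_iff₀ hm0]
    refine h1.trans_lt ?_
    rw [div_lt_iff₀ hε] at hN2
    have h2 : D * (m / n) ≤ ε / 8 * m := by
      have h3 : D ≤ ε / 8 * n := by nlinarith
      rw [mul_div_assoc', div_le_iff₀ hn0]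
      nlinarith [mul_le_mul_of_nonneg_right h3 hm0.le]
    nlinarith
  obtain ⟨m, hm⟩ := cauchySeq_tendsto_of_complete hcauchy
  refine ⟨m, hF.1, fun ε hε => ?_⟩
  obtain ⟨D, hD, h1, h2⟩ := hcomp (ε / 4) (by positivity)
  refine ⟨8 * D / ε, by positivity, fun T hT a => ?_⟩
  have hT0 : 0 < T := lt_of_lt_of_le (by positivity) hT
  have h3 : ‖I T - T * m‖ ≤ 2 * (ε / 4) * T + D * (T * 0 + 1) := by
    refine le_of_tendsto_of_tendsto (b := atTop) (f := fun n : ℕ => ‖I T - T * (I n / n)‖)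
      (g := fun n : ℕ => 2 * (ε / 4) * T + D * (T * ((n : ℝ)⁻¹) + 1)) ?_ ?_ ?_
    · exact ((hm.const_mul _).const_sub _).norm
    · exact (((tendsto_inv_atTop_nhds_zero_nat.const_mul T).add_const 1).const_mul D).const_add _
    · filter_upwards [eventually_gt_atTop 0] with n hn
      simpa [div_eq_mul_inv] using h2 T hT0.le n hn
  have h4 := h1 T hT0.le a
  rw [div_le_iff₀ hε] at hT
  have e : (∫ t in a..(a + T), F t) - T * m =
    ((∫ t in a..(a + T), F t) - I T) + (I T - T * m) := by ring
  rw [e]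
  refine (norm_add_le _ _).trans ?_
  nlinarith

lemma HasUMean.add {F G : ℝ → ℂ} {m n : ℂ} (hF : HasUMean F m) (hG : HasUMean G n) :
    HasUMean (fun t => F t + G t) (m + n) := by
  refine ⟨hF.1.add hG.1, fun ε hε => ?_⟩
  obtain ⟨T₁, h1, h1'⟩ := hF.2 (ε / 2) (half_pos hε)
  obtain ⟨T₂, h2, h2'⟩ := hG.2 (ε / 2) (half_pos hε)
  refine ⟨max T₁ T₂, lt_max_of_lt_left h1, fun T hT a => ?_⟩
  rw [intervalIntegral.integral_add (hF.1.intervalIntegrable _ _) (hG.1.intervalIntegrable _ _),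
    mul_add, add_sub_add_comm]
  refine (norm_add_le _ _).trans ?_
  have a1 := h1' T ((le_max_left _ _).trans hT) a
  have a2 := h2' T ((le_max_right _ _).trans hT) a
  linarith

lemma HasUMean.const_mul {F : ℝ → ℂ} {m : ℂ} (hF : HasUMean F m) (c : ℂ) :
    HasUMean (fun t => c * F t) (c * m) := by
  refine ⟨continuous_const.mul hF.1, fun ε hε => ?_⟩
  obtain ⟨T₁, h1, h1'⟩ := hF.2 (ε / (‖c‖ + 1)) (by positivity)
  refine ⟨T₁, h1, fun T hT a => ?_⟩
  rw [intervalIntegral.integral_const_mul, mul_left_comm, ← mul_sub, norm_mul]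
  have hT0 : 0 ≤ T := h1.le.trans hT
  calc _ ≤ (‖c‖ + 1) * (ε / (‖c‖ + 1) * T) := by
        gcongr
        · linarith
        · exact h1' T hT a
    _ = ε * T := by field_simp

lemma hasUMean_const (c : ℂ) : HasUMean (fun _ => c) c := by
  refine ⟨continuous_const, fun ε hε => ⟨1, one_pos, fun T hT a => ?_⟩⟩
  simp; nlinarith

lemma HasUMean.sub {F G : ℝ → ℂ} {m n : ℂ} (hF : HasUMean F m) (hG : HasUMean G n) :
    HasUMean (fun t => F t - G t) (m - n) := by
  simpa [sub_eq_add_neg] using hF.add (hG.const_mul (-1))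

lemma HasUMean.finset_sum {ι : Type*} {F : ι → ℝ → ℂ} {m : ι → ℂ} (s : Finset ι)
    (h : ∀ i ∈ s, HasUMean (F i) (m i)) :
    HasUMean (fun t => ∑ i ∈ s, F i t) (∑ i ∈ s, m i) := by
  classical
  induction s using Finset.induction_on with
  | empty => simpa using hasUMean_const 0
  | insert i s hi ih =>
    simp only [Finset.sum_insert hi]
    exact (h i (by simp)).add (ih fun j hj => h j (by simp [hj]))

lemma integral_osc {μ : ℝ} (hμ : μ ≠ 0) (a b : ℝ) :
    ∫ t in a..b, osc μ t = (osc μ b - osc μ a) / (μ * Complex.I) := by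
  have h : (μ : ℂ) * Complex.I ≠ 0 := mul_ne_zero (by exact_mod_cast hμ) Complex.I_ne_zero
  have e : ∀ t : ℝ, osc μ t = Complex.exp (μ * Complex.I * t) := fun t => by
    rw [osc]; push_cast; ring_nf
  simp only [e]
  exact integral_exp_mul_complex h

lemma hasUMean_osc {μ : ℝ} (hμ : μ ≠ 0) : HasUMean (osc μ) 0 := by
  refine ⟨continuous_osc μ, fun ε hε => ?_⟩
  have hμ' : 0 < |μ| := abs_pos.2 hμ
  refine ⟨2 / |μ| / ε, by positivity, fun T hT a => ?_⟩
  rw [div_le_iff₀ hε] at hT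
  rw [mul_zero, sub_zero, integral_osc hμ, norm_div, norm_mul, Complex.norm_I, mul_one,
    Complex.norm_real, Real.norm_eq_abs, mul_comm ε]
  refine le_trans ?_ hT
  gcongr
  refine (norm_sub_le _ _).trans ?_
  simp; norm_num

lemma hasUMean_osc_ite (μ : ℝ) : HasUMean (osc μ) (if μ = 0 then 1 else 0) := by
  split_ifs with h
  · subst h
    have : osc 0 = fun _ => 1 := by ext t; simp
    rw [this]; exact hasUMean_const 1
  · exact hasUMean_osc h

lemma HasUMean.of_uniform_approx {F : ℝ → ℂ} {m : ℂ} (hc : Continuous F)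
    (h : ∀ ε : ℝ, 0 < ε → ∃ G m', HasUMean G m' ∧ (∀ t, ‖F t - G t‖ ≤ ε) ∧ ‖m - m'‖ ≤ ε) :
    HasUMean F m := by
  refine ⟨hc, fun ε hε => ?_⟩
  obtain ⟨G, m', hG, hFG, hm⟩ := h (ε / 3) (by positivity)
  obtain ⟨T₁, h1, h1'⟩ := hG.2 (ε / 3) (by positivity)
  refine ⟨T₁, h1, fun T hT a => ?_⟩
  have hT0 : 0 ≤ T := h1.le.trans hT
  have b1 : ‖∫ t in a..(a + T), (F t - G t)‖ ≤ ε / 3 * T := by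
    refine (intervalIntegral.norm_integral_le_of_norm_le_const fun t _ => hFG t).trans ?_
    rw [add_sub_cancel_left, abs_of_nonneg hT0]
  have b3 : ‖(T : ℂ) * (m - m')‖ ≤ ε / 3 * T := by
    rw [norm_mul, Complex.norm_real, Real.norm_of_nonneg hT0, mul_comm]; gcongr
  have e : (∫ t in a..(a + T), F t) - T * m = (∫ t in a..(a + T), (F t - G t)) +
      ((∫ t in a..(a + T), G t) - T * m') + -(T * (m - m')) := by
    rw [intervalIntegral.integral_sub (hc.intervalIntegrable _ _) (hG.1.intervalIntegrable _ _)]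
    ring
  rw [e]
  refine norm_add₃_le.trans ?_
  rw [norm_neg]
  linarith [h1' T hT a]

lemma HasUMean.tendsto {F : ℝ → ℂ} {m : ℂ} (h : HasUMean F m) :
    Tendsto (fun T : ℝ => (1 / (2 * (T : ℂ))) * ∫ t in (-T)..T, F t) atTop (𝓝 m) := by
  rw [Metric.tendsto_atTop]
  intro ε hε
  obtain ⟨T₁, h1, h1'⟩ := h.2 (ε / 2) (half_pos hε)
  refine ⟨T₁, fun T hT => ?_⟩
  have hT0 : 0 < T := h1.trans_le hT
  have hTc : (T : ℂ) ≠ 0 := by exact_mod_cast hT0.ne'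
  have h2 := h1' (2 * T) (by linarith) (-T)
  rw [show -T + 2 * T = T by ring] at h2
  rw [dist_eq_norm, show (1 / (2 * (T : ℂ))) * (∫ t in (-T)..T, F t) - m =
    ((∫ t in (-T)..T, F t) - ((2 * T : ℝ) : ℂ) * m) / (2 * T) by push_cast; field_simp, norm_div,
    norm_mul, Complex.norm_real, Real.norm_of_nonneg hT0.le, Complex.norm_ofNat,
    div_lt_iff₀ (by positivity)]
  nlinarith

lemma HasUMean.unique {F : ℝ → ℂ} {m n : ℂ} (h : HasUMean F m) (h' : HasUMean F n) : m = n :=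
  tendsto_nhds_unique h.tendsto h'.tendsto

lemma HasUMean.re_nonpos {F : ℝ → ℂ} {m : ℂ} (h : HasUMean F m) (hF : ∀ t, (F t).re ≤ 0) :
    m.re ≤ 0 := by
  refine le_of_forall_pos_le_add fun ε hε => ?_
  obtain ⟨T, hT, h1⟩ := h.2 ε hε
  have h2 := h1 T le_rfl 0
  rw [zero_add] at h2
  have h3 : (∫ t in (0 : ℝ)..T, F t).re ≤ 0 := by
    have e : (∫ t in (0 : ℝ)..T, F t).re = ∫ t in (0 : ℝ)..T, (F t).re :=
      (Complex.reCLM.intervalIntegral_comp_comm (h.1.intervalIntegrable 0 T)).symm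
    rw [e]
    have := intervalIntegral.integral_mono_on (μ := MeasureTheory.volume) hT.le
      ((Complex.continuous_re.comp h.1).intervalIntegrable 0 T)
      (continuous_const.intervalIntegrable 0 T) (g := fun _ => (0 : ℝ)) (fun t _ => hF t)
    simpa using this
  have h4 := (Complex.abs_re_le_norm _).trans h2
  rw [Complex.sub_re, Complex.re_ofReal_mul] at h4
  have h5 := (abs_le.1 h4).1
  have : T * m.re ≤ T * (0 + ε) := by linarith
  exact le_of_mul_le_mul_left this hT

/-! ### Bohr's inequality and Kronecker's theorem. -/

/-- Finite sets of reals that are almost invariant under finitely many `ℚ`-independent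
translations. -/
lemma exists_finset_almost_invariant (S : Finset ℝ) (hS : LinearIndependent ℚ (fun x : S => (x : ℝ)))
    (m : ℕ) : ∃ B : Finset ℝ, B.Nonempty ∧ ∀ x ∈ S,
      m * B.card ≤ (m + 1) * ((B ×ˢ B).filter fun p => p.2 - p.1 = x).card := by
  classical
  let φ : (S → ℕ) → ℝ := fun k => ∑ i : S, (k i : ℝ) * i
  have hφ : Function.Injective φ := by
    intro k k' h
    have h0 : ∑ i : S, ((k i : ℚ) - (k' i : ℚ)) • (i : ℝ) = 0 := by
      have : φ k - φ k' = 0 := sub_eq_zero.2 h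
      rw [← this]
      simp only [φ, ← Finset.sum_sub_distrib]
      refine Finset.sum_congr rfl fun i _ => ?_
      rw [Rat.smul_def]; push_cast; ring
    ext i
    have := Fintype.linearIndependent_iff.1 hS _ h0 i
    exact_mod_cast sub_eq_zero.1 this
  -- `B` is the image of the box `{0, …, m}^S` under integer combinations. Adding `x` raises one
  -- coordinate by one and stays in the box unless that coordinate is `m`, so a fraction `m / (m +
  -- 1)` survives.
  let K : Finset (S → ℕ) := Fintype.piFinset fun _ => Finset.range (m + 1)
  have hK : K.Nonempty := ⟨fun _ => 0, by simp [K]⟩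
  refine ⟨K.image φ, hK.image φ, fun x hx => ?_⟩
  let j : S := ⟨x, hx⟩
  let K' : Finset (S → ℕ) :=
    Fintype.piFinset (Function.update (fun _ => Finset.range (m + 1)) j (Finset.range m))
  have hK'mem : ∀ k ∈ K', k j < m ∧ k ∈ K := by
    intro k hk
    rw [Fintype.mem_piFinset] at hk
    have hj := hk j
    simp only [Function.update_self, Finset.mem_range] at hj
    refine ⟨hj, ?_⟩
    rw [Fintype.mem_piFinset]
    intro i
    by_cases hi : i = j
    · subst hi; simp; omega
    · simpa [hi] using hk i
  have hcard : m * K.card = (m + 1) * K'.card := by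
    have e1 : K.card = (m + 1) * ∏ i ∈ Finset.univ.erase j, (m + 1) := by
      rw [Fintype.card_piFinset, ← Finset.mul_prod_erase _ _ (Finset.mem_univ j)]
      simp
    have e2 : K'.card = m * ∏ i ∈ Finset.univ.erase j, (m + 1) := by
      rw [Fintype.card_piFinset, ← Finset.mul_prod_erase _ _ (Finset.mem_univ j)]
      congr 1
      · simp
      · refine Finset.prod_congr rfl fun i hi => ?_
        simp [Finset.ne_of_mem_erase hi]
    rw [e1, e2]; ring
  rw [Finset.card_image_of_injective _ hφ, hcard]
  gcongr
  refine Finset.card_le_card_of_injOn (fun k => (φ k, φ (k + Pi.single j 1))) ?_ ?_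
  · intro k hk
    obtain ⟨h1, h2⟩ := hK'mem k hk
    have h3 : k + Pi.single j 1 ∈ K := by
      rw [Fintype.mem_piFinset] at h2 ⊢
      intro i
      by_cases hi : i = j
      · subst hi; simp; omega
      · simpa [hi] using h2 i
    simp only [Finset.coe_filter, Finset.mem_product, Set.mem_ofPred_eq]
    refine ⟨⟨Finset.mem_image_of_mem _ h2, Finset.mem_image_of_mem _ h3⟩, ?_⟩
    simp only [φ, Pi.add_apply, Nat.cast_add, add_mul, Finset.sum_add_distrib, add_sub_cancel_left]
    rw [Finset.sum_eq_single j]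
    · simp [j]
    · intro b _ hb; simp [hb]
    · simp
  · intro k _ k' _ h
    exact hφ (Prod.mk.injEq .. ▸ h).1

lemma exists_linearMap_of_linearIndependent {s : Set ℝ}
    (hs : LinearIndependent ℚ (fun x : s => (x : ℝ))) (θ : ℝ → ℝ) :
    ∃ ψ : ℝ →ₗ[ℚ] ℝ, ∀ x ∈ s, ψ x = θ x := by
  have hs' : LinearIndepOn ℚ id s := hs
  let b := Module.Basis.extend hs'
  refine ⟨b.constr ℚ fun x => θ x, fun x hx => ?_⟩
  have h := b.constr_basis ℚ (fun x => θ x) ⟨x, Module.Basis.subset_extend hs' hx⟩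
  rwa [Module.Basis.extend_apply_self] at h

lemma osc_neg_arg_mul (z : ℂ) : osc (-z.arg) 1 * z = ‖z‖ := by
  have h : osc (-z.arg) 1 * Complex.exp (z.arg * Complex.I) = 1 := by
    have e : Complex.exp (z.arg * Complex.I) = osc z.arg 1 := by simp [osc]
    rw [e, ← osc_add_left]; simp
  calc osc (-z.arg) 1 * z = osc (-z.arg) 1 * (‖z‖ * Complex.exp (z.arg * Complex.I)) := by
        rw [Complex.norm_mul_exp_arg_mul_I]
    _ = ‖z‖ := by rw [mul_left_comm, h, mul_one]

/-- A function with `ℚ`-independent exponents whose real part is bounded above by `C` has absolute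
sum of Fourier coefficients at most `C`. -/
lemma sum_norm_coeff_le {F : ℝ → ℂ} {a : ℝ → ℂ} {C : ℝ}
    (ha : ∀ x, HasUMean (fun t => F t * osc (-x) t) (a x))
    (hind : LinearIndependent ℚ (fun x : {x | a x ≠ 0} => (x : ℝ)))
    (hC : ∀ t, (F t).re ≤ C) (S : Finset ℝ) : ∑ x ∈ S, ‖a x‖ ≤ C := by
  classical
  wlog hS : ∀ x ∈ S, a x ≠ 0 generalizing S with H
  · have := H (S.filter fun x => a x ≠ 0) (fun x hx => (Finset.mem_filter.1 hx).2)
    rwa [Finset.sum_filter_of_ne] at this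
    intro x _ hx; exact norm_ne_zero_iff.1 hx
  have hSind : LinearIndependent ℚ (fun x : S => (x : ℝ)) :=
    hind.comp (fun x : S => (⟨x, hS x x.2⟩ : {x | a x ≠ 0}))
      fun x y h => Subtype.ext (congrArg (fun z : {x | a x ≠ 0} => (z : ℝ)) h)
  -- Independence lets the arguments of the coefficients extend to an additive function on `ℝ`. The
  -- phase attached to a pair of frequencies then depends only on their difference.
  obtain ⟨ψ, hψ⟩ := exists_linearMap_of_linearIndependent hind fun x => (a x).arg
  have hψa : ∀ x, osc (-ψ x) 1 * a x = ‖a x‖ := by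
    intro x
    by_cases hx : a x = 0
    · simp [hx]
    · rw [hψ x hx, osc_neg_arg_mul]
  have key : ∀ B : Finset ℝ, ∑ p ∈ B ×ˢ B, ‖a (p.2 - p.1)‖ ≤ C * B.card := by
    intro B
    -- The kernel `|Q|²` has mean `B.card`, while `F |Q|²` has as mean the sum of the moduli `‖a
    -- (p.2 - p.1)‖` over pairs. Since the kernel is nonnegative, the bound on `Re F` passes to the
    -- means.
    let Q : ℝ → ℂ := fun t => ∑ μ ∈ B, osc (ψ μ) 1 * osc μ t
    have hQ : ∀ t, Q t * (starRingEnd ℂ) (Q t) =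
        ∑ p ∈ B ×ˢ B, osc (ψ p.1 - ψ p.2) 1 * osc (p.1 - p.2) t := by
      intro t
      simp only [Q, map_sum, map_mul, conj_osc, Finset.sum_mul_sum, Finset.sum_product]
      refine Finset.sum_congr rfl fun x _ => Finset.sum_congr rfl fun y _ => ?_
      rw [sub_eq_add_neg, sub_eq_add_neg, osc_add_left, osc_add_left]; ring
    have h1 : HasUMean (fun t => F t * (Q t * (starRingEnd ℂ) (Q t)))
        (∑ p ∈ B ×ˢ B, (‖a (p.2 - p.1)‖ : ℂ)) := by
      have : ∀ p ∈ B ×ˢ B, HasUMean (fun t => osc (ψ p.1 - ψ p.2) 1 *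
          (F t * osc (-(p.2 - p.1)) t)) (‖a (p.2 - p.1)‖ : ℂ) := by
        intro p _
        have := (ha (p.2 - p.1)).const_mul (osc (-ψ (p.2 - p.1)) 1)
        rw [hψa] at this
        simpa using this
      convert HasUMean.finset_sum _ this using 2 with t
      rw [hQ, Finset.mul_sum]
      refine Finset.sum_congr rfl fun p _ => ?_
      rw [neg_sub]; ring
    have h2 : HasUMean (fun t => Q t * (starRingEnd ℂ) (Q t)) (B.card : ℂ) := by
      have : ∀ p ∈ B ×ˢ B, HasUMean (fun t => osc (ψ p.1 - ψ p.2) 1 *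
          osc (p.1 - p.2) t) (if p.1 = p.2 then 1 else 0) := by
        intro p _
        have := (hasUMean_osc_ite (p.1 - p.2)).const_mul (osc (ψ p.1 - ψ p.2) 1)
        convert this using 1
        by_cases h : p.1 = p.2 <;> simp [h, sub_eq_zero]
      have h3 := HasUMean.finset_sum _ this
      have e : ∑ p ∈ B ×ˢ B, (if p.1 = p.2 then (1 : ℂ) else 0) = B.card := by
        rw [Finset.sum_product]; simp
      rw [e] at h3
      simpa only [hQ] using h3
    have h3 := (h1.sub (h2.const_mul C)).re_nonpos ?_
    · have e : (∑ p ∈ B ×ˢ B, (‖a (p.2 - p.1)‖ : ℂ)) - C * B.card =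
        (((∑ p ∈ B ×ˢ B, ‖a (p.2 - p.1)‖) - C * B.card : ℝ) : ℂ) := by push_cast; rfl
      rw [e, Complex.ofReal_re] at h3
      linarith
    · intro t
      rw [← sub_mul, Complex.mul_conj, Complex.re_mul_ofReal]
      refine mul_nonpos_of_nonpos_of_nonneg ?_ (Complex.normSq_nonneg _)
      simpa using hC t
  have hm : ∀ m : ℕ, (m : ℝ) * ∑ x ∈ S, ‖a x‖ ≤ (m + 1) * C := by
    intro m
    obtain ⟨B, hB, h⟩ := exists_finset_almost_invariant S hSind m
    have hB0 : (0 : ℝ) < B.card := by exact_mod_cast hB.card_pos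
    have h1 : ∑ x ∈ S, (((B ×ˢ B).filter fun p => p.2 - p.1 = x).card : ℝ) * ‖a x‖ ≤
        ∑ p ∈ B ×ˢ B, ‖a (p.2 - p.1)‖ := by
      calc _ = ∑ x ∈ S, ∑ p ∈ ((B ×ˢ B).filter fun p => p.2 - p.1 ∈ S) with p.2 - p.1 = x,
              ‖a (p.2 - p.1)‖ := by
            refine Finset.sum_congr rfl fun x hx => ?_
            rw [Finset.filter_filter, Finset.sum_congr (g := fun _ => ‖a x‖)
              (s₂ := (B ×ˢ B).filter fun p => p.2 - p.1 = x)]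
            · simp
            · ext p; simp only [Finset.mem_filter, and_congr_right_iff, and_iff_right_iff_imp]
              rintro _ rfl; exact hx
            · intro p hp; rw [(Finset.mem_filter.1 hp).2]
        _ = ∑ p ∈ (B ×ˢ B).filter fun p => p.2 - p.1 ∈ S, ‖a (p.2 - p.1)‖ :=
            Finset.sum_fiberwise_of_maps_to (fun p hp => (Finset.mem_filter.1 hp).2) _
        _ ≤ _ := Finset.sum_le_sum_of_subset_of_nonneg (Finset.filter_subset _ _)
            fun _ _ _ => norm_nonneg _
    have h2 : (m : ℝ) * B.card * ∑ x ∈ S, ‖a x‖ ≤ (m + 1) * (C * B.card) := by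
      refine le_trans ?_ (mul_le_mul_of_nonneg_left (h1.trans (key B)) (by positivity))
      rw [Finset.mul_sum, Finset.mul_sum]
      refine Finset.sum_le_sum fun x hx => ?_
      rw [← mul_assoc]
      refine mul_le_mul_of_nonneg_right ?_ (norm_nonneg _)
      exact_mod_cast h x hx
    refine le_of_mul_le_mul_right ?_ hB0
    linarith
  have hlim : Tendsto (fun m : ℕ => (1 + 1 / (m : ℝ)) * C) atTop (𝓝 ((1 + 0) * C)) :=
    (tendsto_one_div_atTop_nhds_zero_nat.const_add 1).mul_const C
  rw [add_zero, one_mul] at hlim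
  refine ge_of_tendsto hlim ?_
  filter_upwards [eventually_gt_atTop 0] with m hm0
  have hm0' : (0 : ℝ) < m := by exact_mod_cast hm0
  rw [one_add_div hm0'.ne', div_mul_eq_mul_div, le_div_iff₀ hm0', mul_comm]
  exact hm m

/-- **Kronecker's theorem**: for `ℚ`-independent frequencies the phases can be prescribed
approximately. -/
lemma exists_norm_osc_sub_le (S : Finset ℝ) (hS : LinearIndependent ℚ (fun x : S => (x : ℝ)))
    (z : ℝ → ℂ) (hz : ∀ x, ‖z x‖ = 1) {δ : ℝ} (hδ : 0 < δ) :
    ∃ t : ℝ, ∀ x ∈ S, ‖osc x t - z x‖ ≤ δ := by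
  classical
  -- For unimodular numbers `‖u - z‖² = 2 - 2 Re (conj z * u)`, so a real part of at least `1 - η`
  -- gives distance at most `δ`.
  set η := δ ^ 2 / 2 with hη
  have hη0 : 0 < η := by positivity
  let F : ℝ → ℂ := fun t => ∑ x ∈ S, (starRingEnd ℂ) (z x) * osc x t
  let a : ℝ → ℂ := fun y => if y ∈ S then (starRingEnd ℂ) (z y) else 0
  have ha : ∀ y, HasUMean (fun t => F t * osc (-y) t) (a y) := by
    intro y
    have : ∀ x ∈ S, HasUMean (fun t => (starRingEnd ℂ) (z x) * osc (x - y) t)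
        ((starRingEnd ℂ) (z x) * if x - y = 0 then 1 else 0) := fun x _ =>
      (hasUMean_osc_ite (x - y)).const_mul _
    convert HasUMean.finset_sum _ this using 2 with t
    · simp only [F, Finset.sum_mul]
      refine Finset.sum_congr rfl fun x _ => ?_
      rw [sub_eq_add_neg, osc_add_left, mul_assoc]
    · simp only [a, sub_eq_zero, mul_ite, mul_one, mul_zero, Finset.sum_ite_eq']
  have hsupp : {y | a y ≠ 0} ⊆ (S : Set ℝ) := by
    intro y hy
    by_contra h
    exact hy (if_neg h)
  have hind : LinearIndependent ℚ (fun x : {y | a y ≠ 0} => (x : ℝ)) :=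
    LinearIndependent.comp (R := ℚ) (v := fun x : S => (x : ℝ)) hS
      (fun x : {y | a y ≠ 0} => (⟨x, hsupp x.2⟩ : S))
      fun x y h => Subtype.ext (congrArg (fun z : S => (z : ℝ)) h)
  have hsum : ∑ x ∈ S, ‖a x‖ = S.card := by
    rw [Finset.card_eq_sum_ones, Nat.cast_sum]
    refine Finset.sum_congr rfl fun x hx => ?_
    simp [a, hx, hz]
  -- By Bohr's inequality `Re F` cannot stay below the coefficient sum `S.card`. When it nearly
  -- reaches that value, each of its summands, being at most `1`, is nearly `1`.
  obtain ⟨t, ht⟩ : ∃ t, (S.card : ℝ) - η < (F t).re := by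
    by_contra! h
    have := sum_norm_coeff_le ha hind h S
    linarith
  refine ⟨t, fun x hx => ?_⟩
  have hre : ∀ y, ((starRingEnd ℂ) (z y) * osc y t).re ≤ 1 := fun y =>
    (Complex.re_le_norm _).trans (by simp [hz])
  have h1 : 1 - η ≤ ((starRingEnd ℂ) (z x) * osc x t).re := by
    have h2 : (F t).re = ((starRingEnd ℂ) (z x) * osc x t).re +
        ∑ y ∈ S.erase x, ((starRingEnd ℂ) (z y) * osc y t).re := by
      rw [Finset.add_sum_erase _ (fun y => ((starRingEnd ℂ) (z y) * osc y t).re) hx]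
      simp [F]
    have h3 : ∑ y ∈ S.erase x, ((starRingEnd ℂ) (z y) * osc y t).re ≤ (S.erase x).card := by
      refine (Finset.sum_le_card_nsmul _ _ 1 fun y _ => hre y).trans (by simp)
    have h4 : ((S.erase x).card : ℝ) + 1 = S.card := by
      exact_mod_cast Finset.card_erase_add_one hx
    linarith
  have h5 : ‖osc x t - z x‖ ^ 2 = 2 - 2 * ((starRingEnd ℂ) (z x) * osc x t).re := by
    have e1 : (osc x t).re ^ 2 + (osc x t).im ^ 2 = 1 := by
      have := Complex.sq_norm (osc x t)
      rw [norm_osc, Complex.normSq_apply] at this; nlinarith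
    have e2 : (z x).re ^ 2 + (z x).im ^ 2 = 1 := by
      have := Complex.sq_norm (z x)
      rw [hz, Complex.normSq_apply] at this; nlinarith
    rw [Complex.sq_norm, Complex.normSq_apply]
    simp only [Complex.sub_re, Complex.sub_im, Complex.mul_re, Complex.conj_re, Complex.conj_im]
    nlinarith
  refine abs_le_of_sq_le_sq' ?_ hδ.le |>.2
  rw [h5]; linarith

/-! ### The uniqueness theorem for almost periodic functions. -/

lemma norm_integral_le_of_blocks {g : ℝ → ℂ} (hg : Continuous g) {B C L : ℝ} (hL : 0 < L)
    (hC : ∀ t, ‖g t‖ ≤ C) (h : ∀ a, ‖∫ t in a..(a + L), g t‖ ≤ B * L) {T : ℝ} (hT : 0 ≤ T) (a : ℝ) :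
    ‖∫ t in a..(a + T), g t‖ ≤ B * T + C * L := by
  have hB : 0 ≤ B := nonneg_of_mul_nonneg_left ((norm_nonneg _).trans (h 0)) hL
  have hC0 : 0 ≤ C := (norm_nonneg _).trans (hC 0)
  have hi : ∀ x y : ℝ, IntervalIntegrable g MeasureTheory.volume x y :=
    fun x y => hg.intervalIntegrable x y
  have hn : ∀ n : ℕ, ‖∫ t in a..(a + n * L), g t‖ ≤ B * (n * L) := by
    intro n
    induction n with
    | zero => simp
    | succ n ih =>
      rw [← intervalIntegral.integral_add_adjacent_intervals (hi a (a + n * L)) (hi _ _)]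
      refine (norm_add_le _ _).trans ?_
      have := h (a + n * L)
      rw [show a + n * L + L = a + (n + 1 : ℕ) * L by push_cast; ring] at this
      refine (add_le_add ih this).trans (le_of_eq ?_)
      push_cast; ring
  have h0 : (0 : ℝ) ≤ T / L := by positivity
  have h1 := Nat.floor_le h0
  have h2 := Nat.lt_floor_add_one (T / L)
  set n := ⌊T / L⌋₊
  rw [le_div_iff₀ hL] at h1
  rw [div_lt_iff₀ hL] at h2
  rw [← intervalIntegral.integral_add_adjacent_intervals (hi a (a + n * L)) (hi _ _)]
  refine (norm_add_le _ _).trans (add_le_add ((hn n).trans (by gcongr)) ?_)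
  refine (intervalIntegral.norm_integral_le_of_norm_le_const fun t _ => hC t).trans ?_
  gcongr
  rw [abs_of_nonneg (by linarith)]
  linarith

/-- If all the mean values of `G` against oscillations vanish, they are small uniformly for
bounded frequencies. -/
lemma IsAP.exists_uniform_small {G : ℝ → ℂ} (hG : IsAP G)
    (h0 : ∀ x, HasUMean (fun t => G t * osc x t) 0) (R : ℝ) {ε : ℝ} (hε : 0 < ε) :
    ∃ T₀ : ℝ, 0 < T₀ ∧ ∀ T, T₀ ≤ T → ∀ x ∈ Set.Icc (-R) R, ∀ a,
      ‖∫ t in a..(a + T), G t * osc x t‖ ≤ ε * T := by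
  obtain ⟨C, hC, hGC⟩ := hG.exists_norm_le
  have hcont : ∀ x, Continuous fun t => G t * osc x t := fun x => hG.1.mul (continuous_osc x)
  refine (isCompact_Icc (a := -R) (b := R)).induction_on
    (p := fun s => ∃ T₀ : ℝ, 0 < T₀ ∧ ∀ T, T₀ ≤ T → ∀ x ∈ s, ∀ a,
      ‖∫ t in a..(a + T), G t * osc x t‖ ≤ ε * T) ⟨1, one_pos, by simp⟩ ?_ ?_ ?_
  · rintro s t hst ⟨T₀, h1, h2⟩
    exact ⟨T₀, h1, fun T hT x hx => h2 T hT x (hst hx)⟩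
  · rintro s t ⟨T₁, h1, h1'⟩ ⟨T₂, h2, h2'⟩
    refine ⟨max T₁ T₂, lt_max_of_lt_left h1, fun T hT x hx => ?_⟩
    rcases hx with hx | hx
    · exact h1' T ((le_max_left _ _).trans hT) x hx
    · exact h2' T ((le_max_right _ _).trans hT) x hx
  · intro x _
    obtain ⟨L, hL, hx⟩ := (h0 x).2 (ε / 3) (by positivity)
    -- Over a block of length `L`, changing the frequency by `r` changes the integrand by at most `C
    -- * (r * L) = ε / 3`, after the constant phase at the start of the block is factored out. Long
    -- intervals are cut into blocks, and the threshold `3 * C * L / ε` absorbs the incomplete one.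
    set r := ε / 3 / (C * L) with hr
    have hr0 : 0 < r := by positivity
    refine ⟨_, mem_nhdsWithin_of_mem_nhds (Metric.closedBall_mem_nhds x hr0),
      3 * C * L / ε, by positivity, fun T hT y hy a => ?_⟩
    rw [Metric.mem_closedBall, Real.dist_eq] at hy
    have hT0 : 0 ≤ T := le_trans (by positivity) hT
    have hblock : ∀ a, ‖∫ t in a..(a + L), G t * osc y t‖ ≤ (2 * ε / 3) * L := by
      intro a
      have e : (∫ t in a..(a + L), G t * osc y t) = osc (y - x) a *
          ((∫ t in a..(a + L), G t * osc x t) +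
            ∫ t in a..(a + L), G t * osc x t * (osc (y - x) (t - a) - 1)) := by
        rw [← intervalIntegral.integral_add ((hcont x).intervalIntegrable _ _)
          (Continuous.intervalIntegrable (by have := hcont x; fun_prop) _ _),
          ← intervalIntegral.integral_const_mul]
        refine intervalIntegral.integral_congr fun t _ => ?_
        have e1 : osc y t = osc x t * (osc (y - x) a * osc (y - x) (t - a)) := by
          rw [← osc_add_right, add_sub_cancel, ← osc_add_left, add_sub_cancel]
        simp only [e1]; ring
      have b1 := hx L le_rfl a
      rw [mul_zero, sub_zero] at b1
      have b2 : ‖∫ t in a..(a + L), G t * osc x t * (osc (y - x) (t - a) - 1)‖ ≤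
          (ε / 3) * L := by
        refine (intervalIntegral.norm_integral_le_of_norm_le_const (C := ε / 3)
          fun t ht => ?_).trans ?_
        · rw [Set.uIoc_of_le (by linarith)] at ht
          rw [norm_mul, norm_mul, norm_osc, mul_one]
          have h3 : ‖osc (y - x) (t - a) - 1‖ ≤ r * L := by
            have := norm_osc_sub_osc_le (y - x) (t - a) 0
            rw [osc_zero_right, sub_zero] at this
            refine this.trans ?_
            gcongr
            rw [abs_of_pos (by linarith [ht.1])]; linarith [ht.2]
          calc _ ≤ C * (r * L) := mul_le_mul (hGC t) h3 (norm_nonneg _) hC.le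
            _ = ε / 3 := by rw [hr]; field_simp
        · rw [add_sub_cancel_left, abs_of_pos hL]
      rw [e, norm_mul, norm_osc, one_mul]
      refine (norm_add_le _ _).trans ?_
      linarith
    refine (norm_integral_le_of_blocks (hcont y) hL (C := C)
      (fun t => by simpa using hGC t) hblock hT0 a).trans ?_
    rw [div_le_iff₀ hε] at hT
    linarith

lemma half_le_norm_integral_osc {h x : ℝ} (hh : 0 < h) (hx : |x * h| ≤ Real.pi) :
    h / 2 ≤ ‖∫ u in (0 : ℝ)..h, osc x u‖ := by
  rcases eq_or_ne x 0 with rfl | hx0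
  · simp [abs_of_pos hh]; linarith
  · have hpi := Real.pi_pos
    have hx' : 0 < |x| := abs_pos.2 hx0
    rw [integral_osc hx0, norm_div, norm_mul, Complex.norm_I, mul_one, Complex.norm_real,
      Real.norm_eq_abs, le_div_iff₀ hx', osc_zero_right, osc, mul_comm _ Complex.I,
      Complex.norm_exp_I_mul_ofReal_sub_one, norm_mul, Real.norm_ofNat, Real.norm_eq_abs]
    have h1 : |x * h / 2| ≤ Real.pi / 2 := by
      rw [abs_div, abs_two]; linarith
    have h2 := Real.mul_abs_le_abs_sin h1
    rw [abs_div, abs_two, abs_mul, abs_of_pos hh] at h2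
    have h3 : (1 : ℝ) / 2 ≤ 2 / Real.pi := by
      rw [div_le_div_iff₀ two_pos hpi]; linarith [Real.pi_le_four]
    have h4 : 1 / 2 * (|x| * h / 2) ≤ 2 / Real.pi * (|x| * h / 2) := by gcongr
    linarith

/-- Riemann sums of `G` against oscillations are controlled by the corresponding integrals. -/
lemma norm_sum_sample_le {G : ℝ → ℂ} (hG : Continuous G) {h κ x a : ℝ} (hh : 0 < h)
    (hx : |x * h| ≤ Real.pi) (huc : ∀ u v, |u - v| ≤ h → ‖G u - G v‖ ≤ κ) (n : ℕ)
    (hint : ‖∫ t in a..(a + n * h), G t * osc x t‖ ≤ κ * (n * h)) :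
    ‖∑ j ∈ Finset.range n, G (a + j * h) * osc x (a + j * h)‖ ≤ 4 * κ * n := by
  have hc : Continuous fun t => G t * osc x t := hG.mul (continuous_osc x)
  set J := ∫ u in (0 : ℝ)..h, osc x u with hJ
  have e1 : (∫ t in a..(a + n * h), G t * osc x t) =
      ∑ j ∈ Finset.range n, ∫ t in (a + j * h)..(a + (j + 1 : ℕ) * h), G t * osc x t := by
    have := intervalIntegral.sum_integral_adjacent_intervals (μ := MeasureTheory.volume)
      (f := fun t => G t * osc x t) (a := fun j : ℕ => a + j * h) (n := n)
      fun k _ => hc.intervalIntegrable _ _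
    rw [this]; simp
  -- Only `G` is frozen on each cell. The oscillation is integrated exactly and gives the same
  -- factor `J` in every cell, which can be divided out because `|x * h| ≤ π` forces `‖J‖ ≥ h / 2`.
  have e2 : ∀ j : ℕ, ‖(∫ t in (a + j * h)..(a + (j + 1 : ℕ) * h), G t * osc x t) -
      G (a + j * h) * osc x (a + j * h) * J‖ ≤ κ * h := by
    intro j
    have e3 : G (a + j * h) * osc x (a + j * h) * J =
        ∫ t in (a + j * h)..(a + (j + 1 : ℕ) * h), G (a + j * h) * osc x t := by
      rw [intervalIntegral.integral_const_mul, mul_assoc, hJ,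
        ← intervalIntegral.integral_const_mul]
      congr 1
      simp only [← osc_add_right]
      rw [intervalIntegral.integral_comp_add_left]
      congr 1 <;> push_cast <;> ring
    rw [e3, ← intervalIntegral.integral_sub (hc.intervalIntegrable _ _)
      (Continuous.intervalIntegrable (by fun_prop) _ _)]
    have hle : a + j * h ≤ a + (j + 1 : ℕ) * h := by push_cast; nlinarith
    refine (intervalIntegral.norm_integral_le_of_norm_le_const (C := κ)
      fun t ht => ?_).trans ?_
    · rw [Set.uIoc_of_le hle] at ht
      rw [← sub_mul, norm_mul, norm_osc, mul_one]
      refine huc _ _ ?_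
      have h2 := ht.2
      push_cast at h2
      rw [abs_of_pos (by linarith [ht.1])]; linarith
    · rw [abs_of_nonneg (by linarith)]
      push_cast
      refine le_of_eq ?_; ring
  have e4 : ‖(∫ t in a..(a + n * h), G t * osc x t) -
      (∑ j ∈ Finset.range n, G (a + j * h) * osc x (a + j * h)) * J‖ ≤ n * (κ * h) := by
    rw [e1, Finset.sum_mul, ← Finset.sum_sub_distrib]
    refine (norm_sum_le_of_le _ fun j _ => e2 j).trans ?_
    simp
  set P₀ := ∑ j ∈ Finset.range n, G (a + j * h) * osc x (a + j * h)
  have e5 : ‖P₀‖ * (h / 2) ≤ 2 * κ * n * h := by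
    calc ‖P₀‖ * (h / 2) ≤ ‖P₀‖ * ‖J‖ := by
          gcongr; exact half_le_norm_integral_osc hh hx
      _ = ‖P₀ * J‖ := (norm_mul _ _).symm
      _ ≤ ‖∫ t in a..(a + n * h), G t * osc x t‖ +
          ‖(∫ t in a..(a + n * h), G t * osc x t) - P₀ * J‖ := by
          rw [norm_sub_rev]; exact norm_le_norm_add_norm_sub' _ _
      _ ≤ 2 * κ * n * h := by linarith
  refine le_of_mul_le_mul_right ?_ (half_pos hh)
  linarith

-- By Parseval both sides are averages over the unit circle, where `|p q|² ≤ M² |q|²`.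
open Polynomial in
lemma sum_sq_norm_coeff_mul_le (p q : ℂ[X]) {M : ℝ} (hM : ∀ z : ℂ, ‖z‖ = 1 → ‖p.eval z‖ ≤ M) :
    ∑ i ∈ (p * q).support, ‖(p * q).coeff i‖ ^ 2 ≤ M ^ 2 * ∑ i ∈ q.support, ‖q.coeff i‖ ^ 2 := by
  rw [sum_sq_norm_coeff_eq_circleAverage, sum_sq_norm_coeff_eq_circleAverage]
  have e := Real.circleAverage_smul (f := fun z : ℂ => ‖q.eval z‖ ^ 2) (c := 0) (R := 1)
    (a := M ^ 2)
  rw [smul_eq_mul] at e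
  rw [← e]
  refine Real.circleAverage_mono ?_ ?_ fun z hz => ?_
  · exact ContinuousOn.circleIntegrable' (by fun_prop)
  · exact ContinuousOn.circleIntegrable' (by
      refine ContinuousOn.const_smul (Continuous.continuousOn (by fun_prop)) _)
  · have hz1 : ‖z‖ = 1 := by simpa using hz
    simp only [Pi.smul_apply, smul_eq_mul, eval_mul, norm_mul, mul_pow]
    gcongr
    exact hM z hz1

-- Multiply the polynomial `p` of samples by `q = ∑ X ^ s` over `E`. For `s' ∈ E` the coefficient of
-- index `N + s'` is the sum of `G ((s' - s) h)` over `s ∈ E`, which is close to `E.card * G 0`.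
-- Parseval bounds the squares of these `E.card` coefficients together by `M² * E.card`.
open Polynomial in
lemma card_mul_le_of_sample {G : ℝ → ℂ} {h ε M : ℝ} {N : ℕ} (E : Finset ℕ) (hE : E.Nonempty)
    (hEN : ∀ s ∈ E, s < N) (hM : 0 ≤ M)
    (hclose : ∀ s ∈ E, ∀ s' ∈ E, ‖G ((s' : ℝ) * h - s * h) - G 0‖ ≤ ε)
    (hsum : ∀ z : ℂ, ‖z‖ = 1 →
      ‖∑ j ∈ Finset.range (2 * N), G (-(N * h) + j * h) * z ^ j‖ ≤ M) :
    E.card * (‖G 0‖ - ε) ≤ M := by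
  classical
  rcases le_or_gt (‖G 0‖ - ε) 0 with hneg | hpos
  · exact (mul_nonpos_of_nonneg_of_nonpos (Nat.cast_nonneg _) hneg).trans hM
  let p : ℂ[X] := ∑ j ∈ Finset.range (2 * N), C (G (-(N * h) + j * h)) * X ^ j
  let q : ℂ[X] := ∑ s ∈ E, X ^ s
  have hp : ∀ k, k < 2 * N → p.coeff k = G (-(N * h) + k * h) := by
    intro k hk
    simp only [p, finsetSum_coeff, coeff_C_mul_X_pow]
    rw [Finset.sum_ite_eq (Finset.range (2 * N)) k]
    simp [hk]
  have hq : ∀ k, q.coeff k = if k ∈ E then 1 else 0 := by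
    intro k
    simp only [q, finsetSum_coeff, coeff_X_pow]
    rw [Finset.sum_ite_eq E k]
  have hpq := sum_sq_norm_coeff_mul_le p q (M := M) (fun z hz => by
    simpa [p, eval_finsetSum] using hsum z hz)
  have hqsum : ∑ i ∈ q.support, ‖q.coeff i‖ ^ 2 = E.card := by
    have : q.support = E := by ext k; simp [hq]
    rw [this, Finset.card_eq_sum_ones, Nat.cast_sum]
    refine Finset.sum_congr rfl fun k hk => ?_
    simp [hq, hk]
  rw [hqsum] at hpq
  have hcoeff : ∀ s' ∈ E, E.card * (‖G 0‖ - ε) ≤ ‖(p * q).coeff (N + s')‖ := by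
    intro s' hs'
    have e : (p * q).coeff (N + s') = ∑ s ∈ E, G ((s' : ℝ) * h - s * h) := by
      simp only [q, Finset.mul_sum, finsetSum_coeff, coeff_mul_X_pow']
      refine Finset.sum_congr rfl fun s hs => ?_
      have h1 := hEN s hs
      have h2 := hEN s' hs'
      rw [if_pos (by omega), hp _ (by omega), Nat.cast_sub (by omega)]
      congr 1; push_cast; ring
    have e2 : ‖(p * q).coeff (N + s') - E.card * G 0‖ ≤ E.card * ε := by
      have : (E.card : ℂ) * G 0 = ∑ s ∈ E, G 0 := by simp
      rw [e, this, ← Finset.sum_sub_distrib]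
      exact (norm_sum_le_of_le _ fun s hs => hclose s hs s' hs').trans (by simp)
    have e3 : ‖(E.card : ℂ) * G 0‖ = E.card * ‖G 0‖ := by simp
    have e4 := norm_sub_norm_le ((E.card : ℂ) * G 0) ((p * q).coeff (N + s'))
    rw [norm_sub_rev, e3] at e4
    linarith
  have hE0 : (0 : ℝ) < E.card := by exact_mod_cast hE.card_pos
  have hX : 0 < E.card * (‖G 0‖ - ε) := by positivity
  have hlow : E.card * (E.card * (‖G 0‖ - ε)) ^ 2 ≤
      ∑ i ∈ (p * q).support, ‖(p * q).coeff i‖ ^ 2 := by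
    calc E.card * (E.card * (‖G 0‖ - ε)) ^ 2 = ∑ s ∈ E, (E.card * (‖G 0‖ - ε)) ^ 2 := by simp
      _ ≤ ∑ s ∈ E, ‖(p * q).coeff (N + s)‖ ^ 2 := by
          refine Finset.sum_le_sum fun s hs => ?_
          gcongr; exact hcoeff s hs
      _ = ∑ i ∈ E.image (N + ·), ‖(p * q).coeff i‖ ^ 2 :=
          (Finset.sum_image (f := fun i => ‖(p * q).coeff i‖ ^ 2)
            fun x _ y _ hxy => Nat.add_left_cancel hxy).symm
      _ ≤ _ := by
          refine Finset.sum_le_sum_of_subset_of_nonneg ?_ fun _ _ _ => by positivity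
          intro i hi
          obtain ⟨s, hs, rfl⟩ := Finset.mem_image.1 hi
          rw [mem_support_iff, ← norm_ne_zero_iff]
          exact (hX.trans_le (hcoeff s hs)).ne'
  have hfin : (E.card * (‖G 0‖ - ε)) ^ 2 ≤ M ^ 2 := by
    refine le_of_mul_le_mul_left ?_ hE0
    linarith
  exact abs_le_of_sq_le_sq' hfin hM |>.2

/-- **Uniqueness theorem**: an almost periodic function all of whose Fourier coefficients vanish
is zero. -/
lemma IsAP.eq_zero_of_means {G : ℝ → ℂ} (hG : IsAP G)
    (h0 : ∀ x, HasUMean (fun t => G t * osc x t) 0) : G 0 = 0 := by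
  classical
  by_contra hne
  set A := ‖G 0‖ with hA
  have hA0 : 0 < A := norm_pos_iff.2 hne
  obtain ⟨n, col, hcol⟩ := hG.2 (A / 2) (by positivity)
  have hn : 0 < n := (Nat.zero_le _).trans_lt (col 0).2
  have hnR : (0 : ℝ) < n := by exact_mod_cast hn
  -- The most frequent colour class `E` has `N ≤ n * E.card`, so the upper bound `8 * κ * N` is at
  -- most `A / 4 * E.card`. This contradicts the lower bound `A / 2 * E.card`.
  set κ := A / (32 * n) with hκ
  have hκ0 : 0 < κ := by positivity
  obtain ⟨h, hh, huc⟩ := hG.isBohrAP.uniformContinuous hG.1 κ hκ0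
  obtain ⟨T₀, hT₀, hsmall⟩ := hG.exists_uniform_small h0 (Real.pi / h) hκ0
  obtain ⟨N, hN⟩ := exists_nat_gt (T₀ / h)
  have hNR : (0 : ℝ) < N := lt_trans (by positivity) hN
  rw [div_lt_iff₀ hh] at hN
  have hsum : ∀ z : ℂ, ‖z‖ = 1 →
      ‖∑ j ∈ Finset.range (2 * N), G (-(N * h) + j * h) * z ^ j‖ ≤ 8 * κ * N := by
    -- Each `z` on the unit circle is the sampled oscillation of frequency `arg z / h`. These
    -- frequencies stay in `[-π/h, π/h]`, where the smallness of the means is uniform.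
    intro z hz
    set x := z.arg / h with hx
    have hxh : x * h = z.arg := by rw [hx]; field_simp
    have harg := Complex.abs_arg_le_pi z
    have hxR : x ∈ Set.Icc (-(Real.pi / h)) (Real.pi / h) := by
      rw [Set.mem_Icc, ← abs_le, hx, abs_div, abs_of_pos hh]; gcongr
    have hz' : ∀ j : ℕ, osc x (j * h) = z ^ j := by
      intro j
      have h1 : Complex.exp (z.arg * Complex.I) = z := by
        have := Complex.norm_mul_exp_arg_mul_I z
        rwa [hz, Complex.ofReal_one, one_mul] at this
      conv_rhs => rw [← h1]
      rw [← Complex.exp_nat_mul, osc, show x * (j * h) = j * (x * h) by ring, hxh]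
      push_cast; ring_nf
    have h2 := norm_sum_sample_le hG.1 (a := -(N * h)) hh (hxh ▸ harg) huc (2 * N)
      (hsmall _ (by push_cast; nlinarith) x hxR _)
    have e : ∑ j ∈ Finset.range (2 * N), G (-(N * h) + j * h) * osc x (-(N * h) + j * h) =
        osc x (-(N * h)) * ∑ j ∈ Finset.range (2 * N), G (-(N * h) + j * h) * z ^ j := by
      rw [Finset.mul_sum]
      refine Finset.sum_congr rfl fun j _ => ?_
      rw [osc_add_right, hz']; ring
    rw [e, norm_mul, norm_osc, one_mul] at h2
    refine h2.trans (le_of_eq ?_)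
    push_cast; ring
  obtain ⟨i, hi⟩ : ∃ i : Fin n, N ≤ n * ((Finset.range N).filter fun s : ℕ => col (s * h) = i).card := by
    by_contra! hlt
    have h1 : (Finset.range N).card = ∑ i : Fin n,
        ((Finset.range N).filter fun s : ℕ => col (s * h) = i).card :=
      Finset.card_eq_sum_card_fiberwise fun _ _ => Finset.mem_coe.2 (Finset.mem_univ _)
    have h2 : n * N < n * N := by
      calc n * N = ∑ i : Fin n, n * ((Finset.range N).filter fun s : ℕ => col (s * h) = i).card := by
            rw [← Finset.mul_sum, ← h1, Finset.card_range]
        _ < ∑ i : Fin n, N := Finset.sum_lt_sum_of_nonempty ⟨⟨0, hn⟩, Finset.mem_univ _⟩ fun i _ => hlt i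
        _ = n * N := by simp
    exact lt_irrefl _ h2
  set E := (Finset.range N).filter fun s : ℕ => col (s * h) = i with hE
  have hiR : (N : ℝ) ≤ n * E.card := by exact_mod_cast hi
  have hEne : E.Nonempty := by
    rw [← Finset.card_pos]
    by_contra hcon
    have : E.card = 0 := by omega
    rw [this] at hiR
    simp only [Nat.cast_zero, mul_zero] at hiR
    linarith
  have hfin := card_mul_le_of_sample (G := G) (h := h) (ε := A / 2) E hEne
    (fun s hs => by simpa using (Finset.mem_filter.1 hs).1) (by positivity) ?_ hsum
  · have h3 : κ * (32 * n) = A := by rw [hκ]; field_simp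
    have h4 : (E.card : ℝ) * (A - A / 2) ≤ A / 4 * E.card := by
      refine hfin.trans ?_
      calc 8 * κ * N ≤ 8 * κ * (n * E.card) := by gcongr
        _ = A / 4 * E.card := by rw [← h3]; ring
    have hE0 : (0 : ℝ) < E.card := by exact_mod_cast hEne.card_pos
    nlinarith
  · intro s hs s' hs'
    have := hcol (s' * h) (s * h)
      (((Finset.mem_filter.1 hs').2).trans (Finset.mem_filter.1 hs).2.symm) (-(s * h))
    simpa [sub_eq_add_neg] using this

/-! ### Absolutely convergent Fourier series. -/

lemma exists_finset_norm_tsum_sub_le {ι : Type*} {u : ι → ℝ} (hu : Summable u) {ε : ℝ}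
    (hε : 0 < ε) : ∃ S : Finset ι, ∀ S', S ⊆ S' → ∀ f : ι → ℂ, (∀ x, ‖f x‖ ≤ u x) →
      ‖∑' x, f x - ∑ x ∈ S', f x‖ ≤ ε := by
  have h := (tendsto_tsum_compl_atTop_zero u).eventually (ge_mem_nhds hε)
  obtain ⟨S, hS⟩ := eventually_atTop.1 h
  refine ⟨S, fun S' hSS f hf => ?_⟩
  have hfs : Summable f := Summable.of_norm_bounded hu hf
  rw [← hfs.sum_add_tsum_subtype_compl S', add_sub_cancel_left]
  refine (tsum_of_norm_bounded (hu.subtype _).hasSum fun x => hf x).trans ?_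
  exact hS S' hSS

lemma isAP_tsum_osc {a : ℝ → ℂ} (ha : Summable fun x => ‖a x‖) :
    IsAP fun t => ∑' x, a x * osc x t := by
  refine IsAP.of_uniform_approx fun ε hε => ?_
  obtain ⟨S, hS⟩ := exists_finset_norm_tsum_sub_le ha hε
  refine ⟨fun t => ∑ x ∈ S, a x * osc x t,
    IsAP.finset_sum S fun x _ => (isAP_osc x).const_mul (a x), fun t => ?_⟩
  exact hS S subset_rfl _ fun x => by simp

lemma hasUMean_tsum_osc {a : ℝ → ℂ} (ha : Summable fun x => ‖a x‖) (y : ℝ) :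
    HasUMean (fun t => (∑' x, a x * osc x t) * osc (-y) t) (a y) := by
  classical
  refine HasUMean.of_uniform_approx ((isAP_tsum_osc ha).1.mul (continuous_osc _)) fun ε hε => ?_
  obtain ⟨S, hS⟩ := exists_finset_norm_tsum_sub_le ha hε
  refine ⟨fun t => ∑ x ∈ insert y S, a x * osc (x - y) t,
    ∑ x ∈ insert y S, a x * (if x - y = 0 then 1 else 0),
    HasUMean.finset_sum _ fun x _ => (hasUMean_osc_ite (x - y)).const_mul (a x), fun t => ?_, ?_⟩
  · have h := hS (insert y S) (Finset.subset_insert _ _) (fun x => a x * osc x t)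
      fun x => by simp
    have e : ∑ x ∈ insert y S, a x * osc (x - y) t =
        (∑ x ∈ insert y S, a x * osc x t) * osc (-y) t := by
      rw [Finset.sum_mul]
      refine Finset.sum_congr rfl fun x _ => ?_
      rw [sub_eq_add_neg, osc_add_left, mul_assoc]
    beta_reduce
    rw [e, ← sub_mul, norm_mul, norm_osc, mul_one]
    exact h
  · simp only [sub_eq_zero, mul_ite, mul_one, mul_zero, Finset.sum_ite_eq', Finset.mem_insert_self,
      if_true, sub_self, norm_zero]
    exact hε.le

lemma HasUMean.comp_add_right {F : ℝ → ℂ} {m : ℂ} (h : HasUMean F m) (s : ℝ) :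
    HasUMean (fun t => F (t + s)) m := by
  refine ⟨h.1.comp (continuous_id.add continuous_const), fun ε hε => ?_⟩
  obtain ⟨T₀, h1, h2⟩ := h.2 ε hε
  refine ⟨T₀, h1, fun T hT a => ?_⟩
  rw [intervalIntegral.integral_comp_add_right, add_right_comm]
  exact h2 T hT _

/-- An almost periodic function with `ℚ`-independent Fourier exponents is the sum of its absolutely
convergent Fourier series. -/
lemma IsAP.eq_tsum_of_linearIndependent {F : ℝ → ℂ} (hF : IsAP F) {a : ℝ → ℂ}
    (ha : ∀ x, HasUMean (fun t => F t * osc (-x) t) (a x))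
    (hind : LinearIndependent ℚ (fun x : {x | a x ≠ 0} => (x : ℝ))) :
    Summable (fun x => ‖a x‖) ∧ ∀ t, F t = ∑' x, a x * osc x t := by
  obtain ⟨C, -, hC⟩ := hF.exists_norm_le
  have hs : Summable (fun x => ‖a x‖) := summable_of_sum_le (fun _ => norm_nonneg _)
    (sum_norm_coeff_le ha hind fun t => (Complex.re_le_norm _).trans (hC t))
  refine ⟨hs, fun t => ?_⟩
  -- Translating by `t` brings the value at `t` to the origin, the only point at which the
  -- uniqueness theorem is stated.
  have hG := (hF.sub (isAP_tsum_osc hs)).comp_add_right t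
  have h0 := hG.eq_zero_of_means fun x => ?_
  · simp only [zero_add] at h0
    exact sub_eq_zero.1 h0
  · have h1 := ((ha (-x)).sub (hasUMean_tsum_osc hs (-x))).comp_add_right t
    have h2 := h1.const_mul (osc x (-t))
    rw [sub_self, mul_zero] at h2
    convert h2 using 2 with u
    have : osc x u = osc x (-t) * osc x (u + t) := by rw [← osc_add_right]; ring_nf
    rw [this, neg_neg]; ring

/-! ### From almost periodicity in a strip to a Dirichlet series. -/

lemma isOpen_realInterval (α β : EReal) : IsOpen (realInterval α β) :=
  (isOpen_Ioi.preimage continuous_coe_real_ereal).inter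
    (isOpen_Iio.preimage continuous_coe_real_ereal)

lemma ordConnected_realInterval (α β : EReal) : (realInterval α β).OrdConnected :=
  ⟨fun _ hx _ hy _ hz => ⟨hx.1.trans_le (EReal.coe_le_coe_iff.2 hz.1),
    (EReal.coe_le_coe_iff.2 hz.2).trans_lt hy.2⟩⟩

lemma isOpen_verticalStrip (α β : EReal) : IsOpen (verticalStrip α β) :=
  (isOpen_realInterval α β).preimage Complex.continuous_re

lemma mem_verticalStrip_line {α β : EReal} {σ : ℝ} (hσ : σ ∈ realInterval α β) (t : ℝ) :
    (σ : ℂ) + Complex.I * t ∈ verticalStrip α β := by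
  simpa [verticalStrip] using hσ

lemma IsAlmostPeriodicInStrip.isAP_line {f : ℂ → ℂ} {α β : EReal}
    (hf : IsAlmostPeriodicInStrip f α β) {σ : ℝ} (hσ : σ ∈ realInterval α β) :
    IsAP fun t => f ((σ : ℂ) + Complex.I * t) := by
  refine IsBohrAP.isAP (fun ε hε => ?_) ?_
  · obtain ⟨l, hl, h⟩ := hf.2 σ σ hσ.1 hσ.2 ε hε
    refine ⟨l, hl, fun t₀ => ?_⟩
    obtain ⟨τ, hτ, h'⟩ := h t₀
    refine ⟨τ, hτ, fun t => ?_⟩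
    have := h' ((σ : ℂ) + Complex.I * t) (by simp) (by simp)
    convert this using 3
    push_cast; ring_nf
  · exact hf.1.continuousOn.comp_continuous (by fun_prop) fun t => mem_verticalStrip_line hσ t

lemma IsAlmostPeriodicInStrip.exists_norm_le {f : ℂ → ℂ} {α β : EReal}
    (hf : IsAlmostPeriodicInStrip f α β) {a b : ℝ} (ha : a ∈ realInterval α β)
    (hb : b ∈ realInterval α β) :
    ∃ C : ℝ, 0 ≤ C ∧ ∀ s : ℂ, a ≤ s.re → s.re ≤ b → ‖f s‖ ≤ C := by
  obtain ⟨l, hl, h⟩ := hf.2 a b ha.1 hb.2 1 one_pos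
  have hsub : Set.Icc a b ×ℂ Set.Icc 0 l ⊆ verticalStrip α β := fun s hs =>
    (ordConnected_realInterval α β).out ha hb hs.1
  obtain ⟨C, hC⟩ := (isCompact_Icc.reProdIm isCompact_Icc).exists_bound_of_continuousOn
    (hf.1.continuousOn.mono hsub)
  refine ⟨|C| + 1, by positivity, fun s h1 h2 => ?_⟩
  obtain ⟨τ, hτ, h'⟩ := h (-s.im)
  have h3 := h' s h1 h2
  have h4 := hC (s + Complex.I * τ) ⟨by simpa using ⟨h1, h2⟩, by
    simp only [Set.mem_preimage, Complex.add_im, Complex.mul_im, Complex.I_re, Complex.I_im,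
      Complex.ofReal_re, Complex.ofReal_im, Set.mem_Icc]
    constructor <;> linarith [hτ.1, hτ.2]⟩
  rw [norm_sub_rev] at h3
  have h5 := norm_le_norm_add_norm_sub' (f s) (f (s + Complex.I * τ))
  linarith [le_abs_self C]

lemma exp_neg_mul_line (x σ t : ℝ) :
    Complex.exp (-((x : ℂ) * ((σ : ℂ) + Complex.I * (t : ℂ)))) =
      Complex.exp (-(x * σ : ℝ)) * osc (-x) t := by
  rw [osc, ← Complex.exp_add]; push_cast; ring_nf

/-- By Cauchy's theorem the normalized mean values of `f` on vertical lines agree. -/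
lemma IsAlmostPeriodicInStrip.mean_eq {f : ℂ → ℂ} {α β : EReal}
    (hf : IsAlmostPeriodicInStrip f α β) {x σ₁ σ₂ : ℝ} (hσ₁ : σ₁ ∈ realInterval α β)
    (hσ₂ : σ₂ ∈ realInterval α β) (h12 : σ₁ ≤ σ₂) {m₁ m₂ : ℂ}
    (h1 : HasUMean (fun t : ℝ => f ((σ₁ : ℂ) + Complex.I * t) *
      Complex.exp (-((x : ℂ) * ((σ₁ : ℂ) + Complex.I * t)))) m₁)
    (h2 : HasUMean (fun t : ℝ => f ((σ₂ : ℂ) + Complex.I * t) *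
      Complex.exp (-((x : ℂ) * ((σ₂ : ℂ) + Complex.I * t)))) m₂) : m₁ = m₂ := by
  obtain ⟨C, hC, hfC⟩ := hf.exists_norm_le hσ₁ hσ₂
  let g : ℂ → ℂ := fun s => f s * Complex.exp (-(x * s))
  set D := C * Real.exp (|x| * (|σ₁| + |σ₂|)) with hD
  have hgD : ∀ s : ℂ, σ₁ ≤ s.re → s.re ≤ σ₂ → ‖g s‖ ≤ D := by
    intro s hs1 hs2
    rw [norm_mul, Complex.norm_exp]
    refine mul_le_mul (hfC s hs1 hs2) (Real.exp_le_exp.2 ?_) (Real.exp_pos _).le hC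
    have e : (-((x : ℂ) * s)).re = -(x * s.re) := by simp
    rw [e]
    have h3 : |s.re| ≤ |σ₁| + |σ₂| := by
      rw [abs_le]
      constructor <;> linarith [neg_abs_le σ₁, le_abs_self σ₂, abs_nonneg σ₁, abs_nonneg σ₂]
    calc -(x * s.re) ≤ |x * s.re| := neg_le_abs _
      _ = |x| * |s.re| := abs_mul _ _
      _ ≤ _ := by gcongr
  have hdiff : ∀ T : ℝ, DifferentiableOn ℂ g
      (Set.uIcc ((σ₁ : ℂ) + (-T : ℝ) * Complex.I).re ((σ₂ : ℂ) + (T : ℝ) * Complex.I).re ×ℂ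
      Set.uIcc ((σ₁ : ℂ) + (-T : ℝ) * Complex.I).im ((σ₂ : ℂ) + (T : ℝ) * Complex.I).im) := by
    intro T
    have : DifferentiableOn ℂ g (verticalStrip α β) := hf.1.mul (by fun_prop)
    refine this.mono fun s hs => ?_
    have h3 := hs.1
    simp only [Set.mem_preimage, Complex.add_re, Complex.ofReal_re, Complex.mul_re, Complex.I_re,
      mul_zero, Complex.ofReal_im, Complex.I_im, mul_one, sub_self, add_zero,
      Set.uIcc_of_le h12] at h3
    exact (ordConnected_realInterval α β).out hσ₁ hσ₂ h3
  -- The horizontal sides of the rectangle contribute an amount bounded independently of `T`, which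
  -- disappears after division by `2 * T`.
  have hrect : ∀ T : ℝ, ‖(∫ t in (-T)..T, g ((σ₂ : ℂ) + Complex.I * t)) -
      ∫ t in (-T)..T, g ((σ₁ : ℂ) + Complex.I * t)‖ ≤ 2 * (D * (σ₂ - σ₁)) := by
    intro T
    have h := Complex.integral_boundary_rect_eq_zero_of_differentiableOn g _ _ (hdiff T)
    simp only [Complex.add_re, Complex.ofReal_re, Complex.mul_re, Complex.I_re,
      mul_zero, Complex.ofReal_im, Complex.I_im, mul_one, sub_self, add_zero, Complex.add_im,
      Complex.mul_im, zero_add] at h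
    have hb : ∀ y : ℝ, ‖∫ u in σ₁..σ₂, g (u + y * Complex.I)‖ ≤ D * (σ₂ - σ₁) := by
      intro y
      refine (intervalIntegral.norm_integral_le_of_norm_le_const (C := D) fun u hu => ?_).trans ?_
      · rw [Set.uIoc_of_le h12] at hu
        exact hgD _ (by simpa using hu.1.le) (by simpa using hu.2)
      · rw [abs_of_nonneg (by linarith)]
    simp only [smul_eq_mul] at h
    have e : Complex.I * ((∫ t in (-T)..T, g ((σ₂ : ℂ) + Complex.I * t)) -
        ∫ t in (-T)..T, g ((σ₁ : ℂ) + Complex.I * t)) =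
        (∫ u in σ₁..σ₂, g (u + (T : ℝ) * Complex.I)) -
          ∫ u in σ₁..σ₂, g (u + (-T : ℝ) * Complex.I) := by
      simp only [mul_comm Complex.I (_ : ℂ)] at h ⊢
      linear_combination h
    calc _ = ‖Complex.I * ((∫ t in (-T)..T, g ((σ₂ : ℂ) + Complex.I * t)) -
        ∫ t in (-T)..T, g ((σ₁ : ℂ) + Complex.I * t))‖ := by
          rw [norm_mul, Complex.norm_I, one_mul]
      _ ≤ _ := by
          rw [e]
          refine (norm_sub_le _ _).trans ?_
          linarith [hb T, hb (-T)]
  have hlim := h2.tendsto.sub h1.tendsto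
  have hzero : Tendsto (fun T : ℝ => D * (σ₂ - σ₁) * T⁻¹) atTop (𝓝 (D * (σ₂ - σ₁) * 0)) :=
    tendsto_inv_atTop_zero.const_mul _
  rw [mul_zero] at hzero
  have hlim0 : Tendsto (fun T : ℝ => (1 / (2 * (T : ℂ))) *
      (∫ t in (-T)..T, g ((σ₂ : ℂ) + Complex.I * t)) - (1 / (2 * (T : ℂ))) *
      ∫ t in (-T)..T, g ((σ₁ : ℂ) + Complex.I * t)) atTop (𝓝 0) := by
    refine squeeze_zero_norm' ?_ hzero
    filter_upwards [eventually_gt_atTop 0] with T hT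
    rw [← mul_sub, norm_mul, norm_div, norm_one, norm_mul, Complex.norm_ofNat, Complex.norm_real,
      Real.norm_of_nonneg hT.le]
    calc _ ≤ 1 / (2 * T) * (2 * (D * (σ₂ - σ₁))) := by gcongr; exact hrect T
      _ = _ := by field_simp
  exact (sub_eq_zero.1 (tendsto_nhds_unique hlim hlim0)).symm

lemma IsAlmostPeriodicInStrip.exists_coeff {f : ℂ → ℂ} {α β : EReal}
    (hf : IsAlmostPeriodicInStrip f α β) {σ₀ : ℝ} (hσ₀ : σ₀ ∈ realInterval α β) (x : ℝ) :
    ∃ c : ℂ, ∀ σ ∈ realInterval α β, HasUMean (fun t : ℝ => f ((σ : ℂ) + Complex.I * t) *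
      Complex.exp (-((x : ℂ) * ((σ : ℂ) + Complex.I * t)))) c := by
  have hex : ∀ σ ∈ realInterval α β, ∃ m, HasUMean (fun t : ℝ => f ((σ : ℂ) + Complex.I * t) *
      Complex.exp (-((x : ℂ) * ((σ : ℂ) + Complex.I * t)))) m := by
    intro σ hσ
    simp only [exp_neg_mul_line]
    exact ((hf.isAP_line hσ).mul ((isAP_osc (-x)).const_mul _)).exists_hasUMean
  obtain ⟨c, hc⟩ := hex σ₀ hσ₀
  refine ⟨c, fun σ hσ => ?_⟩
  obtain ⟨m, hm⟩ := hex σ hσ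
  rcases le_total σ σ₀ with h | h
  · rwa [← hf.mean_eq hσ hσ₀ h hm hc]
  · rwa [hf.mean_eq hσ₀ hσ h hc hm]

/-- An almost periodic function in a strip with `ℚ`-independent Fourier exponents is the sum of its
absolutely convergent Dirichlet series. -/
lemma IsAlmostPeriodicInStrip.exists_dirichlet_series {f : ℂ → ℂ} {α β : EReal} (hαβ : α < β)
    (hf : IsAlmostPeriodicInStrip f α β)
    (hindep : LinearIndependent ℚ (fun lam : fourierExponents f α β => (lam : ℝ))) :
    ∃ c : ℝ → ℂ, {x | c x ≠ 0} = fourierExponents f α β ∧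
      (∀ σ ∈ realInterval α β, Summable fun x => ‖c x‖ * Real.exp (x * σ)) ∧
      ∀ s ∈ verticalStrip α β, f s = ∑' x : ℝ, c x * Complex.exp (x * s) := by
  obtain ⟨σ₀, hσ₀⟩ : (realInterval α β).Nonempty := by
    obtain ⟨r, h1, h2⟩ := EReal.lt_iff_exists_real_btwn.1 hαβ
    exact ⟨r, h1, h2⟩
  choose c hc using fun x => hf.exists_coeff hσ₀ x
  have hset : {x | c x ≠ 0} = fourierExponents f α β := by
    ext x
    constructor
    · intro hx
      exact ⟨c x, hx, fun σ hσ => (hc x σ hσ).tendsto⟩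
    · rintro ⟨d, hd, hd'⟩
      rw [Set.mem_ofPred_eq, tendsto_nhds_unique (hc x σ₀ hσ₀).tendsto (hd' σ₀ hσ₀)]
      exact hd
  have hline : ∀ σ ∈ realInterval α β, Summable (fun x => ‖c x * Complex.exp (x * σ : ℝ)‖) ∧
      ∀ t : ℝ, f ((σ : ℂ) + Complex.I * t) =
        ∑' x : ℝ, c x * Complex.exp (x * σ : ℝ) * osc x t := by
    intro σ hσ
    refine (hf.isAP_line hσ).eq_tsum_of_linearIndependent (fun x => ?_) ?_
    -- On the line of abscissa `σ` the Fourier coefficient is `c x * e^{x σ}`. It vanishes exactly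
    -- when `c x` does, so independence carries over to each line.
    · have h := (hc x σ hσ).const_mul (Complex.exp (x * σ : ℝ))
      simp only [exp_neg_mul_line] at h
      rw [mul_comm _ (c x)] at h
      convert h using 2 with t
      rw [mul_left_comm, ← mul_assoc (Complex.exp _), ← Complex.exp_add]
      simp
    · have e : {x : ℝ | c x * Complex.exp (x * σ : ℝ) ≠ 0} = fourierExponents f α β := by
        rw [← hset]; ext x; simp [Complex.exp_ne_zero]
      rw [e]; exact hindep
  refine ⟨c, hset, fun σ hσ => ?_, fun s hs => ?_⟩
  · convert (hline σ hσ).1 using 2 with x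
    rw [norm_mul, Complex.norm_exp_ofReal]
  · have h := (hline s.re hs).2 s.im
    have e : (s.re : ℂ) + Complex.I * s.im = s := by
      rw [mul_comm]; exact Complex.re_add_im s
    rw [e] at h
    rw [h]
    refine tsum_congr fun x => ?_
    rw [mul_assoc, osc, ← Complex.exp_add]
    congr 2
    conv_rhs => rw [← e]
    push_cast; ring

/-! ### Closed polygons with prescribed side lengths. -/

/-- Greedy choice: each new term gets the sign opposite to the running sum. -/
lemma exists_signs_abs_sum_le {ι : Type*} {B : ι → ℝ} {M : ℝ} (hB : ∀ n, 0 ≤ B n)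
    (hM : 0 ≤ M) (hBM : ∀ n, B n ≤ M) (S : Finset ι) :
    ∃ e : ι → ℝ, (∀ n, e n = 1 ∨ e n = -1) ∧ |∑ n ∈ S, B n * e n| ≤ M := by
  classical
  induction S using Finset.induction_on with
  | empty => exact ⟨fun _ => 1, fun _ => Or.inl rfl, by simpa using hM⟩
  | insert i S hi ih =>
    obtain ⟨e, he, hS⟩ := ih
    have hsum : ∀ v : ℝ, ∑ n ∈ insert i S, B n * Function.update e i v n =
        B i * v + ∑ n ∈ S, B n * e n := by
      intro v
      rw [Finset.sum_insert hi, Function.update_self]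
      congr 1
      refine Finset.sum_congr rfl fun n hn => ?_
      rw [Function.update_of_ne (by rintro rfl; exact hi hn)]
    have hupd : ∀ v : ℝ, v = 1 ∨ v = -1 →
        ∀ n, Function.update e i v n = 1 ∨ Function.update e i v n = -1 := by
      intro v hv n
      by_cases h : n = i
      · subst h; simpa using hv
      · simpa [h] using he n
    have h1 := hB i
    have h2 := hBM i
    have h3 := abs_le.1 hS
    rcases le_total 0 (∑ n ∈ S, B n * e n) with h | h
    · refine ⟨Function.update e i (-1), hupd _ (Or.inr rfl), ?_⟩
      rw [hsum, abs_le]; constructor <;> linarith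
    · refine ⟨Function.update e i 1, hupd _ (Or.inl rfl), ?_⟩
      rw [hsum, abs_le]; constructor <;> linarith

lemma exists_max_of_summable {ι : Type*} [Nonempty ι] {A : ι → ℝ} (hA : ∀ n, 0 ≤ A n)
    (hs : Summable A) : ∃ n₀, ∀ n, A n ≤ A n₀ := by
  by_cases h : ∃ n, 0 < A n
  · obtain ⟨k, hk⟩ := h
    have hfin : {n | A k ≤ A n}.Finite := by
      have := hs.tendsto_cofinite_zero.eventually (gt_mem_nhds hk)
      rw [eventually_cofinite] at this
      simpa using this
    obtain ⟨n₀, h1, h2⟩ := Set.exists_max_image _ A hfin ⟨k, le_refl (A k)⟩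
    refine ⟨n₀, fun n => ?_⟩
    rcases le_total (A k) (A n) with h | h
    · exact h2 n h
    · exact h.trans h1
  · push Not at h
    exact ⟨Classical.arbitrary ι, fun n => (h n).trans (hA _)⟩

/-- If no side length exceeds the sum of the others, the lengths form a closed polygon. -/
lemma exists_unimodular_tsum_eq_zero {ι : Type*} {A : ι → ℝ} (hA : ∀ n, 0 ≤ A n)
    (hs : Summable A) (h : ∀ n, 2 * A n ≤ ∑' k, A k) :
    ∃ z : ι → ℂ, (∀ n, ‖z n‖ = 1) ∧ ∑' n, z n * A n = 0 := by
  classical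
  rcases isEmpty_or_nonempty ι with hι | hι
  · exact ⟨fun _ => 1, by simp, by simp⟩
  obtain ⟨n₀, hmax⟩ := exists_max_of_summable hA hs
  set M := A n₀ with hM
  let B : ι → ℝ := fun n => if n = n₀ then 0 else A n
  have hB0 : ∀ n, 0 ≤ B n := fun n => by dsimp only [B]; split_ifs; exacts [le_rfl, hA n]
  have hBA : ∀ n, B n ≤ A n := fun n => by dsimp only [B]; split_ifs; exacts [hA n, le_rfl]
  have hBs : Summable B := Summable.of_nonneg_of_le hB0 hBA hs
  have hBsum : ∑' n, A n = M + ∑' n, B n := hs.tsum_eq_add_tsum_ite n₀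
  let T : (ι → ℝ) → ℂ := fun θ => ∑' n, (B n : ℂ) * Complex.exp (θ n * Complex.I)
  have hterm : ∀ (θ : ι → ℝ) n, ‖(B n : ℂ) * Complex.exp (θ n * Complex.I)‖ ≤ B n := by
    intro θ n
    rw [norm_mul, Complex.norm_exp_ofReal_mul_I, mul_one, Complex.norm_real,
      Real.norm_of_nonneg (hB0 n)]
  have hT : Continuous T := continuous_tsum (fun n => by fun_prop) hBs fun n θ => hterm θ n
  have htop : M ≤ ‖T 0‖ := by
    have e : T 0 = ((∑' n, B n : ℝ) : ℂ) := by simp [T, Complex.ofReal_tsum]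
    rw [e, Complex.norm_real, Real.norm_of_nonneg (tsum_nonneg hB0)]
    linarith [h n₀]
  -- Angles `0` and `π` realise the greedy signs on a finite set and give `‖T θ‖ ≤ M + ε` for each
  -- `ε`. Compactness of the cube `[0, π]^ι` removes the `ε`.
  obtain ⟨θ₁, hθ₁⟩ : ∃ θ, ‖T θ‖ ≤ M := by
    have hK : IsCompact (Set.univ.pi fun _ : ι => Set.Icc (0 : ℝ) Real.pi) :=
      isCompact_univ_pi fun _ => isCompact_Icc
    obtain ⟨θ, -, hθ⟩ := hK.exists_isMinOn ⟨fun _ => 0, fun n _ => ⟨le_rfl, Real.pi_pos.le⟩⟩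
      hT.norm.continuousOn
    refine ⟨θ, le_of_forall_pos_le_add fun ε hε => ?_⟩
    obtain ⟨S, hS⟩ := exists_finset_norm_tsum_sub_le hBs hε
    obtain ⟨e, he, heS⟩ := exists_signs_abs_sum_le hB0 (hA n₀)
      (fun n => (hBA n).trans (hmax n)) S
    let θ' : ι → ℝ := fun n => if e n = 1 then 0 else Real.pi
    have hθ' : ∀ n, Complex.exp (θ' n * Complex.I) = e n := by
      intro n
      rcases he n with h1 | h1
      · simp [θ', h1]
      · have : ¬ ((-1 : ℝ) = 1) := by norm_num
        simp [θ', h1, this]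
    have hmem : θ' ∈ Set.univ.pi fun _ : ι => Set.Icc (0 : ℝ) Real.pi := by
      intro n _
      dsimp only [θ']
      split_ifs
      · exact ⟨le_rfl, Real.pi_pos.le⟩
      · exact ⟨Real.pi_pos.le, le_rfl⟩
    refine (hθ hmem).trans ?_
    have h1 := hS S subset_rfl _ (hterm θ')
    have h2 : ‖∑ n ∈ S, (B n : ℂ) * Complex.exp (θ' n * Complex.I)‖ ≤ M := by
      have e2 : ∑ n ∈ S, (B n : ℂ) * Complex.exp (θ' n * Complex.I) =
          ((∑ n ∈ S, B n * e n : ℝ) : ℂ) := by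
        push_cast
        exact Finset.sum_congr rfl fun n _ => by rw [hθ']
      rw [e2, Complex.norm_real]; exact heS
    have h3 := norm_le_norm_add_norm_sub' (T θ') (∑ n ∈ S, (B n : ℂ) * Complex.exp (θ' n * Complex.I))
    change ‖T θ'‖ ≤ _
    linarith
  -- Intermediate values on the connected space `ι → ℝ`: the remaining sides add up to a vector of
  -- length exactly `M`, which the longest side then cancels.
  obtain ⟨θ, hθ⟩ := mem_range_of_exists_le_of_exists_ge hT.norm ⟨θ₁, hθ₁⟩ ⟨0, htop⟩
  let z : ι → ℂ := fun n => if n = n₀ then (if M = 0 then 1 else -(T θ) / M)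
    else Complex.exp (θ n * Complex.I)
  have hz : ∀ n, ‖z n‖ = 1 := by
    intro n
    dsimp only [z]
    split_ifs with h1 h2
    · simp
    · rw [norm_div, norm_neg, Complex.norm_real]
      change ‖T θ‖ = M at hθ
      rw [hθ, Real.norm_of_nonneg (hA n₀), div_self h2]
    · exact Complex.norm_exp_ofReal_mul_I _
  refine ⟨z, hz, ?_⟩
  have hsz : Summable fun n => z n * A n := by
    refine Summable.of_norm_bounded hs fun n => ?_
    rw [norm_mul, hz, one_mul, Complex.norm_real, Real.norm_of_nonneg (hA n)]
  rw [hsz.tsum_eq_add_tsum_ite n₀]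
  have e1 : ∑' n, (if n = n₀ then 0 else z n * A n) = T θ := by
    refine tsum_congr fun n => ?_
    by_cases h1 : n = n₀ <;> simp [z, B, h1, mul_comm]
  rw [e1]
  simp only [z, if_true]
  change ‖T θ‖ = M at hθ
  split_ifs with h2
  · rw [h2, norm_eq_zero] at hθ
    rw [hθ, ← hM, h2]; simp
  · have : (M : ℂ) ≠ 0 := by exact_mod_cast h2
    rw [← hM]; field_simp; ring

/-! ### Absolutely convergent Dirichlet series in a strip. -/

/-- Convergence at the two edges thereby supplies one summable majorant for the whole closed
substrip. -/
lemma exp_mul_le_add_exp {a b y x : ℝ} (ha : a ≤ y) (hb : y ≤ b) :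
    Real.exp (x * y) ≤ Real.exp (x * a) + Real.exp (x * b) := by
  rcases le_total 0 x with h | h
  · have : Real.exp (x * y) ≤ Real.exp (x * b) := Real.exp_le_exp.2 (by gcongr)
    linarith [Real.exp_pos (x * a)]
  · have : Real.exp (x * y) ≤ Real.exp (x * a) :=
      Real.exp_le_exp.2 (mul_le_mul_of_nonpos_left ha h)
    linarith [Real.exp_pos (x * b)]

lemma norm_exp_ofReal_mul (x : ℝ) (s : ℂ) : ‖Complex.exp (x * s)‖ = Real.exp (x * s.re) := by
  rw [Complex.norm_exp, Complex.re_ofReal_mul]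

lemma exists_Ioo_subset_realInterval {α β : EReal} {σ : ℝ} (hσ : σ ∈ realInterval α β) :
    ∃ δ : ℝ, 0 < δ ∧ Set.Icc (σ - δ) (σ + δ) ⊆ realInterval α β := by
  obtain ⟨δ, hδ, h⟩ := Metric.isOpen_iff.1 (isOpen_realInterval α β) σ hσ
  refine ⟨δ / 2, half_pos hδ, fun y hy => h ?_⟩
  rw [Metric.mem_ball, Real.dist_eq, abs_lt]
  constructor <;> linarith [hy.1, hy.2]

section DirichletSeries

variable {α β : EReal} {d : ℝ → ℂ}

lemma differentiableOn_dirichlet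
    (hd : ∀ σ ∈ realInterval α β, Summable fun x => ‖d x‖ * Real.exp (x * σ)) :
    DifferentiableOn ℂ (fun s => ∑' x : ℝ, d x * Complex.exp (x * s)) (verticalStrip α β) := by
  intro s hs
  obtain ⟨δ, hδ, hsub⟩ := exists_Ioo_subset_realInterval (show s.re ∈ realInterval α β from hs)
  have hopen : IsOpen (Complex.re ⁻¹' Set.Ioo (s.re - δ) (s.re + δ)) :=
    isOpen_Ioo.preimage Complex.continuous_re
  have h := Complex.differentiableOn_tsum_of_summable_norm
    (F := fun (x : ℝ) (s : ℂ) => d x * Complex.exp (x * s))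
    (u := fun x => ‖d x‖ * Real.exp (x * (s.re - δ)) + ‖d x‖ * Real.exp (x * (s.re + δ)))
    ((hd _ (hsub ⟨le_rfl, by linarith⟩)).add (hd _ (hsub ⟨by linarith, le_rfl⟩)))
    (fun x => by fun_prop) hopen fun x w hw => by
      rw [norm_mul, norm_exp_ofReal_mul, ← mul_add]
      gcongr
      exact exp_mul_le_add_exp hw.1.le hw.2.le
  exact (h.differentiableAt (hopen.mem_nhds ⟨by linarith, by linarith⟩)).differentiableWithinAt

lemma summable_dirichlet
    (hd : ∀ σ ∈ realInterval α β, Summable fun x => ‖d x‖ * Real.exp (x * σ)) {s : ℂ}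
    (hs : s ∈ verticalStrip α β) : Summable fun x : ℝ => d x * Complex.exp (x * s) :=
  Summable.of_norm_bounded (hd s.re hs) fun x => by rw [norm_mul, norm_exp_ofReal_mul]

lemma coeff_eq_zero_of_dirichlet_eq_zero {σ : ℝ} (hσ : σ ∈ realInterval α β)
    (hd : ∀ σ ∈ realInterval α β, Summable fun x => ‖d x‖ * Real.exp (x * σ))
    (h0 : ∀ s ∈ verticalStrip α β, ∑' x : ℝ, d x * Complex.exp (x * s) = 0) (y : ℝ) : d y = 0 := by
  have hs : Summable fun x => ‖d x * Complex.exp (x * σ)‖ := by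
    convert hd σ hσ using 2 with x
    rw [norm_mul, norm_exp_ofReal_mul, Complex.ofReal_re]
  have h1 := hasUMean_tsum_osc hs y
  have e : ∀ t : ℝ, ∑' x : ℝ, d x * Complex.exp (x * σ) * osc x t = 0 := by
    intro t
    rw [← h0 _ (mem_verticalStrip_line hσ t)]
    refine tsum_congr fun x => ?_
    rw [mul_assoc, osc, ← Complex.exp_add]
    push_cast; ring_nf
  simp only [e, zero_mul] at h1
  have := (hasUMean_const 0).unique h1
  simpa [Complex.exp_ne_zero] using this.symm

lemma isPreconnected_verticalStrip (α β : EReal) : IsPreconnected (verticalStrip α β) := by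
  have h : Convex ℝ (realInterval α β) := (ordConnected_realInterval α β).convex
  exact (h.linear_preimage Complex.reLm).isPreconnected

/-- The sum is the restriction to the real axis of the holomorphic series with coefficients `‖d x‖`.
-/
lemma continuousOn_tsum_norm_exp
    (hd : ∀ σ ∈ realInterval α β, Summable fun x => ‖d x‖ * Real.exp (x * σ)) :
    ContinuousOn (fun σ : ℝ => ∑' x, ‖d x‖ * Real.exp (x * σ)) (realInterval α β) := by
  have h := (differentiableOn_dirichlet (d := fun x => (‖d x‖ : ℂ)) (α := α) (β := β)
    (by simpa using hd)).continuousOn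
  have h2 : ContinuousOn (fun σ : ℝ => ∑' x : ℝ, (‖d x‖ : ℂ) * Complex.exp (x * (σ : ℂ)))
      (realInterval α β) :=
    h.comp Complex.continuous_ofReal.continuousOn fun σ hσ => by simpa [verticalStrip] using hσ
  refine (Complex.continuous_re.comp_continuousOn h2).congr fun σ _ => ?_
  have e : ∑' x : ℝ, (‖d x‖ : ℂ) * Complex.exp (x * (σ : ℂ)) =
      ((∑' x, ‖d x‖ * Real.exp (x * σ) : ℝ) : ℂ) := by
    rw [Complex.ofReal_tsum]; push_cast; rfl
  simp only [Function.comp_apply]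
  rw [e, Complex.ofReal_re]

/-- At a zero, no term of the series dominates the sum of the other terms. -/
lemma two_mul_le_of_dirichlet_eq_zero
    (hd : ∀ σ ∈ realInterval α β, Summable fun x => ‖d x‖ * Real.exp (x * σ)) {s : ℂ}
    (hs : s ∈ verticalStrip α β) (h0 : ∑' x : ℝ, d x * Complex.exp (x * s) = 0) (y : ℝ) :
    2 * (‖d y‖ * Real.exp (y * s.re)) ≤ ∑' x, ‖d x‖ * Real.exp (x * s.re) := by
  classical
  have hd' := hd s.re hs
  rw [(summable_dirichlet hd hs).tsum_eq_add_tsum_ite y] at h0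
  rw [hd'.tsum_eq_add_tsum_ite y]
  have hsm : Summable fun x => if x = y then 0 else ‖d x‖ * Real.exp (x * s.re) := by
    refine Summable.of_nonneg_of_le (fun x => ?_) (fun x => ?_) hd'
    · split_ifs; exacts [le_rfl, by positivity]
    · split_ifs; exacts [by positivity, le_rfl]
  have h1 := tsum_of_norm_bounded (f := fun x : ℝ => if x = y then 0 else d x * Complex.exp (x * s))
    hsm.hasSum fun x => by
      split_ifs
      · simp
      · rw [norm_mul, norm_exp_ofReal_mul]
  rw [eq_neg_of_add_eq_zero_right h0, norm_neg, norm_mul, norm_exp_ofReal_mul] at h1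
  linarith

/-- Vertical translates of a Dirichlet series with `ℚ`-independent exponents approximate the series
with arbitrarily rotated coefficients. -/
lemma exists_translate_approx
    (hd : ∀ σ ∈ realInterval α β, Summable fun x => ‖d x‖ * Real.exp (x * σ))
    (hind : LinearIndependent ℚ (fun x : {x | d x ≠ 0} => (x : ℝ)))
    {w : ℝ → ℂ} (hw : ∀ x, ‖w x‖ = 1) {a b : ℝ} (ha : a ∈ realInterval α β)
    (hb : b ∈ realInterval α β) {ε : ℝ} (hε : 0 < ε) :
    ∃ t : ℝ, ∀ s : ℂ, a ≤ s.re → s.re ≤ b →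
      ‖∑' x : ℝ, d x * Complex.exp (x * (s + Complex.I * t)) -
        ∑' x : ℝ, w x * d x * Complex.exp (x * s)‖ ≤ ε := by
  classical
  set u : ℝ → ℝ := fun x => ‖d x‖ * Real.exp (x * a) + ‖d x‖ * Real.exp (x * b) with hu
  have hus : Summable u := (hd a ha).add (hd b hb)
  have hu0 : ∀ x, 0 ≤ u x := fun x => by positivity
  -- The factor `2` bounds `‖osc x t - w x‖` on the tail. Kronecker's theorem handles the nonzero
  -- terms of the finite part.
  obtain ⟨S, hS⟩ := exists_finset_norm_tsum_sub_le (hus.mul_left 2) (half_pos hε)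
  set U := ∑' x, u x with hU
  have hU0 : 0 ≤ U := tsum_nonneg hu0
  set S' := S.filter fun x => d x ≠ 0 with hS'
  have hind' : LinearIndependent ℚ (fun x : S' => (x : ℝ)) :=
    hind.comp (fun x : S' => (⟨x, (Finset.mem_filter.1 x.2).2⟩ : {x | d x ≠ 0}))
      fun x y h => Subtype.ext (congrArg (fun z : {x | d x ≠ 0} => (z : ℝ)) h)
  obtain ⟨t, ht⟩ := exists_norm_osc_sub_le S' hind' w hw (δ := ε / 2 / (U + 1)) (by positivity)
  refine ⟨t, fun s hsa hsb => ?_⟩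
  have hsr : s.re ∈ realInterval α β := (ordConnected_realInterval α β).out ha hb ⟨hsa, hsb⟩
  have hbd : ∀ x, ‖d x * Complex.exp (x * s)‖ ≤ u x := by
    intro x
    simp only [norm_mul, norm_exp_ofReal_mul, hu, ← mul_add]
    gcongr
    exact exp_mul_le_add_exp hsa hsb
  have e : ∀ x : ℝ, d x * Complex.exp (x * (s + Complex.I * t)) - w x * d x * Complex.exp (x * s) =
      (osc x t - w x) * (d x * Complex.exp (x * s)) := by
    intro x
    have : Complex.exp (x * (s + Complex.I * t)) = osc x t * Complex.exp (x * s) := by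
      rw [osc, ← Complex.exp_add]; push_cast; ring_nf
    rw [this]; ring
  have hs1 : Summable fun x : ℝ => d x * Complex.exp (x * (s + Complex.I * t)) :=
    summable_dirichlet hd (by simpa [verticalStrip] using hsr)
  have hs2 : Summable fun x : ℝ => w x * d x * Complex.exp (x * s) :=
    summable_dirichlet (α := α) (β := β) (by simpa [hw] using hd) hsr
  rw [← hs1.tsum_sub hs2]
  simp only [e]
  have hdist : ∀ x, ‖osc x t - w x‖ ≤ 2 := fun x => by
    refine (norm_sub_le _ _).trans ?_
    rw [norm_osc, hw]; norm_num
  have h1 := hS S subset_rfl (fun x => (osc x t - w x) * (d x * Complex.exp (x * s))) fun x => by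
    rw [norm_mul]
    exact mul_le_mul (hdist x) (hbd x) (norm_nonneg _) two_pos.le
  have h2 : ‖∑ x ∈ S, (osc x t - w x) * (d x * Complex.exp (x * s))‖ ≤ ε / 2 := by
    have h3 : ∀ x ∈ S, ‖(osc x t - w x) * (d x * Complex.exp (x * s))‖ ≤
        ε / 2 / (U + 1) * u x := by
      intro x hx
      by_cases hdx : d x = 0
      · rw [hdx]; simp only [zero_mul, mul_zero, norm_zero]
        exact mul_nonneg (by positivity) (hu0 x)
      · rw [norm_mul]
        exact mul_le_mul (ht x (Finset.mem_filter.2 ⟨hx, hdx⟩)) (hbd x) (norm_nonneg _)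
          (by positivity)
    refine (norm_sum_le_of_le _ h3).trans ?_
    rw [← Finset.mul_sum]
    calc _ ≤ ε / 2 / (U + 1) * U := by
          gcongr; exact hus.sum_le_tsum _ fun x _ => hu0 x
      _ ≤ ε / 2 / (U + 1) * (U + 1) := by gcongr; linarith
      _ = ε / 2 := by field_simp
  have h4 := norm_le_norm_add_norm_sub'
    (∑' x : ℝ, (osc x t - w x) * (d x * Complex.exp (x * s)))
    (∑ x ∈ S, (osc x t - w x) * (d x * Complex.exp (x * s)))
  linarith

end DirichletSeries

/-! ### Zeros near an abscissa without a dominant term. -/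

/-- A form of Hurwitz's theorem: a function close to `g` on a disc centred at an isolated zero of
`g` has a zero in the disc. -/
lemma exists_zero_of_norm_sub_le {F g : ℂ → ℂ} {z : ℂ} {r m : ℝ} (hr : 0 < r) (hm : 0 < m)
    (hF : DifferentiableOn ℂ F (Metric.closedBall z r)) (hg0 : g z = 0)
    (hg : ∀ s ∈ Metric.sphere z r, m ≤ ‖g s‖)
    (hFg : ∀ s ∈ Metric.closedBall z r, ‖F s - g s‖ ≤ m / 4) :
    ∃ s ∈ Metric.closedBall z r, F s = 0 := by
  by_contra! hne
  have hz : z ∈ Metric.closedBall z r := Metric.mem_closedBall_self hr.le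
  have hd : DifferentiableOn ℂ (fun s => (F s)⁻¹) (closure (Metric.ball z r)) := by
    rw [closure_ball z hr.ne']
    exact hF.inv hne
  -- Maximum principle for `1 / F`: `|F| ≥ 3 m / 4` on the circle would force the same at the
  -- centre, where `|F| ≤ m / 4`.
  have h := Complex.norm_le_of_forall_mem_frontier_norm_le (C := 4 / (3 * m)) (z := z)
    Metric.isBounded_ball hd.diffContOnCl (fun s hs => ?_) (subset_closure (Metric.mem_ball_self hr))
  · have h1 := hFg z hz
    rw [hg0, sub_zero] at h1
    have h2 : 0 < ‖F z‖ := norm_pos_iff.2 (hne z hz)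
    rw [norm_inv, inv_le_comm₀ h2 (by positivity), inv_div] at h
    linarith
  · rw [frontier_ball z hr.ne'] at hs
    have h1 := hFg s (Metric.sphere_subset_closedBall hs)
    have h2 := hg s hs
    rw [norm_sub_rev] at h1
    have h3 := norm_le_norm_add_norm_sub' (g s) (F s)
    rw [norm_inv, inv_le_comm₀ (norm_pos_iff.2 (hne s (Metric.sphere_subset_closedBall hs)))
      (by positivity), inv_div]
    linarith

/-- The closure of the real projections of the zeros consists of the abscissas at which no term of
the Dirichlet series dominates the sum of the other terms. -/
lemma mem_closedZeroRealParts_iff {f : ℂ → ℂ} {α β : EReal} {c : ℝ → ℂ} (hc : ∃ x, c x ≠ 0)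
    (hind : LinearIndependent ℚ (fun x : {x | c x ≠ 0} => (x : ℝ)))
    (hs : ∀ σ ∈ realInterval α β, Summable fun x => ‖c x‖ * Real.exp (x * σ))
    (hf : ∀ s ∈ verticalStrip α β, f s = ∑' x : ℝ, c x * Complex.exp (x * s)) {σ : ℝ}
    (hσ : σ ∈ realInterval α β) :
    σ ∈ closedZeroRealParts f α β ↔
      ∀ y, 2 * (‖c y‖ * Real.exp (y * σ)) ≤ ∑' x, ‖c x‖ * Real.exp (x * σ) := by
  constructor
  · rintro ⟨hcl, -⟩ y
    by_contra! hlt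
    have hcont : ContinuousAt (fun σ : ℝ => 2 * (‖c y‖ * Real.exp (y * σ)) -
        ∑' x, ‖c x‖ * Real.exp (x * σ)) σ :=
      ContinuousAt.sub (by fun_prop)
        ((continuousOn_tsum_norm_exp hs).continuousAt ((isOpen_realInterval α β).mem_nhds hσ))
    have hev := hcont.eventually (lt_mem_nhds (sub_pos.2 hlt))
    obtain ⟨σ', h1, s, ⟨hsU, hs0⟩, rfl⟩ := mem_closure_iff_nhds.1 hcl _ hev
    have h2 := two_mul_le_of_dirichlet_eq_zero hs hsU ((hf s hsU).symm.trans hs0) y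
    have h3 : 0 < 2 * (‖c y‖ * Real.exp (y * s.re)) - ∑' x, ‖c x‖ * Real.exp (x * s.re) := h1
    linarith
  · intro h
    refine ⟨?_, hσ⟩
    obtain ⟨z, hz, hz0⟩ := exists_unimodular_tsum_eq_zero (A := fun x => ‖c x‖ * Real.exp (x * σ))
      (fun x => by positivity) (hs σ hσ) h
    -- This rotation replaces the argument of `c x` by that of the polygon side `z x`. The value `1`
    -- at vanishing coefficients keeps `w` unimodular everywhere.
    let w : ℝ → ℂ := fun x => if c x = 0 then 1 else z x * ‖c x‖ / c x
    have hw : ∀ x, ‖w x‖ = 1 := by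
      intro x
      dsimp only [w]
      split_ifs with hx
      · simp
      · rw [norm_div, norm_mul, hz, one_mul, Complex.norm_real, norm_norm,
          div_self (norm_ne_zero_iff.2 hx)]
    have hwc : ∀ x, w x * c x = z x * ‖c x‖ := by
      intro x
      dsimp only [w]
      split_ifs with hx
      · simp [hx]
      · field_simp
    set g : ℂ → ℂ := fun s => ∑' x : ℝ, w x * c x * Complex.exp (x * s) with hg
    have hsw : ∀ σ ∈ realInterval α β, Summable fun x => ‖w x * c x‖ * Real.exp (x * σ) := by
      simpa [hw] using hs
    have hgd : DifferentiableOn ℂ g (verticalStrip α β) := differentiableOn_dirichlet hsw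
    have hga : AnalyticOnNhd ℂ g (verticalStrip α β) :=
      hgd.analyticOnNhd (isOpen_verticalStrip α β)
    have hσU : (σ : ℂ) ∈ verticalStrip α β := by simpa [verticalStrip] using hσ
    have hgσ : g σ = 0 := by
      rw [← hz0, hg]
      refine tsum_congr fun x => ?_
      rw [hwc]; push_cast; ring
    -- The zero of `g` at `σ` is isolated: otherwise `g` vanishes on the strip, and then so do all
    -- its coefficients.
    have hne : ∀ᶠ s in 𝓝[≠] (σ : ℂ), g s ≠ 0 := by
      rcases (hga _ hσU).eventually_eq_zero_or_eventually_ne_zero with h0 | h0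
      · exfalso
        have := hga.eqOn_zero_of_preconnected_of_eventuallyEq_zero
          (isPreconnected_verticalStrip α β) hσU h0
        obtain ⟨x, hx⟩ := hc
        have h1 := coeff_eq_zero_of_dirichlet_eq_zero hσ hsw (fun s hs => this hs) x
        have h2 := hw x
        rcases mul_eq_zero.1 h1 with h3 | h3
        · rw [h3] at h2; simp at h2
        · exact hx h3
      · exact h0
    rw [Metric.mem_closure_iff]
    intro ε hε
    obtain ⟨δ, hδ, hδs⟩ := exists_Ioo_subset_realInterval hσ
    obtain ⟨ρ, hρ, hρs⟩ := Metric.mem_nhdsWithin_iff.1 hne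
    set r := min (ε / 2) (min δ (ρ / 2)) with hr
    have hr0 : 0 < r := by positivity
    have hrε : r ≤ ε / 2 := min_le_left _ _
    have hrδ : r ≤ δ := (min_le_right _ _).trans (min_le_left _ _)
    have hrρ : r ≤ ρ / 2 := (min_le_right _ _).trans (min_le_right _ _)
    have hball : ∀ s ∈ Metric.closedBall (σ : ℂ) r, σ - r ≤ s.re ∧ s.re ≤ σ + r := by
      intro s hs
      rw [Metric.mem_closedBall, dist_eq_norm] at hs
      have := abs_le.1 ((Complex.abs_re_le_norm _).trans hs)
      rw [Complex.sub_re, Complex.ofReal_re] at this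
      constructor <;> linarith [this.1, this.2]
    have hmemU : ∀ s ∈ Metric.closedBall (σ : ℂ) r, s ∈ verticalStrip α β := fun s hs =>
      hδs ⟨by linarith [(hball s hs).1], by linarith [(hball s hs).2]⟩
    have hsph : IsCompact (Metric.sphere (σ : ℂ) r) := isCompact_sphere _ _
    have hsphne : (Metric.sphere (σ : ℂ) r).Nonempty :=
      NormedSpace.sphere_nonempty.2 hr0.le
    obtain ⟨p, hp, hpmin⟩ := hsph.exists_isMinOn hsphne
      ((hgd.continuousOn.mono fun s hs => hmemU s (Metric.sphere_subset_closedBall hs)).norm)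
    have hm : 0 < ‖g p‖ := by
      refine norm_pos_iff.2 (hρs ⟨?_, ?_⟩)
      · rw [Metric.mem_ball, Metric.mem_sphere.1 hp]; linarith
      · exact Metric.ne_of_mem_sphere hp hr0.ne'
    obtain ⟨t, ht⟩ := exists_translate_approx hs hind hw (a := σ - r) (b := σ + r)
      (hδs ⟨by linarith, by linarith⟩) (hδs ⟨by linarith, by linarith⟩)
      (ε := ‖g p‖ / 4) (by positivity)
    have hshift : ∀ s ∈ verticalStrip α β, s + Complex.I * t ∈ verticalStrip α β := by
      intro s hs
      simpa [verticalStrip] using hs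
    let F : ℂ → ℂ := fun s => ∑' x : ℝ, c x * Complex.exp (x * (s + Complex.I * t))
    have hFd : DifferentiableOn ℂ F (Metric.closedBall (σ : ℂ) r) :=
      (differentiableOn_dirichlet hs).comp (t := verticalStrip α β)
        (f := fun s : ℂ => s + Complex.I * t) (by fun_prop)
        fun s hs => hshift s (hmemU s hs)
    obtain ⟨s, hsb, hs0⟩ := exists_zero_of_norm_sub_le (F := F) (g := g) hr0 hm hFd hgσ
      (fun s hs => hpmin hs) fun s hs => ht s (hball s hs).1 (hball s hs).2
    have hsU := hshift s (hmemU s hsb)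
    refine ⟨s.re, ⟨s + Complex.I * t, ⟨hsU, (hf _ hsU).trans hs0⟩, by simp⟩, ?_⟩
    rw [Real.dist_eq, abs_lt]
    constructor <;> linarith [(hball s hsb).1, (hball s hsb).2]

/-! ### Abscissas at which one term dominates. -/

section Dominance

variable {α β : EReal} {c : ℝ → ℂ}

/-- The set of abscissas at which a given term dominates is convex. -/
lemma tsum_lt_two_mul_of_between
    (hs : ∀ σ ∈ realInterval α β, Summable fun x => ‖c x‖ * Real.exp (x * σ)) {y u v σ : ℝ}
    (hu : u ∈ realInterval α β) (hv : v ∈ realInterval α β) (huσ : u < σ) (hσv : σ < v)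
    (h1 : ∑' x, ‖c x‖ * Real.exp (x * u) < 2 * (‖c y‖ * Real.exp (y * u)))
    (h2 : ∑' x, ‖c x‖ * Real.exp (x * v) < 2 * (‖c y‖ * Real.exp (y * v))) :
    ∑' x, ‖c x‖ * Real.exp (x * σ) < 2 * (‖c y‖ * Real.exp (y * σ)) := by
  have hσ : σ ∈ realInterval α β :=
    (ordConnected_realInterval α β).out hu hv ⟨huσ.le, hσv.le⟩
  -- After division by `e^{y w}` dominance says that a convex function of `w` lies below the
  -- constant `2 * ‖c y‖`.
  have norm_eq : ∀ w : ℝ, (∑' x, ‖c x‖ * Real.exp (x * w)) * Real.exp (-(y * w)) =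
      ∑' x, ‖c x‖ * Real.exp ((x - y) * w) := by
    intro w
    rw [← tsum_mul_right]
    refine tsum_congr fun x => ?_
    rw [mul_assoc, ← Real.exp_add]; ring_nf
  have hsum : ∀ w ∈ realInterval α β, Summable fun x => ‖c x‖ * Real.exp ((x - y) * w) := by
    intro w hw
    refine (summable_congr fun x => ?_).1 ((hs w hw).mul_right (Real.exp (-(y * w))))
    rw [mul_assoc, ← Real.exp_add]; ring_nf
  have key : ∀ w : ℝ, ∑' x, ‖c x‖ * Real.exp (x * w) < 2 * (‖c y‖ * Real.exp (y * w)) ↔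
      ∑' x, ‖c x‖ * Real.exp ((x - y) * w) < 2 * ‖c y‖ := by
    intro w
    rw [← norm_eq, ← mul_lt_mul_iff_left₀ (Real.exp_pos (-(y * w)))]
    have : 2 * (‖c y‖ * Real.exp (y * w)) * Real.exp (-(y * w)) = 2 * ‖c y‖ := by
      rw [mul_assoc, mul_assoc, ← Real.exp_add]; simp
    rw [this]
  rw [key] at h1 h2 ⊢
  have hvu : 0 < v - u := by linarith
  set p := (v - σ) / (v - u) with hp
  set q := (σ - u) / (v - u) with hq
  have hp0 : 0 < p := div_pos (by linarith) hvu
  have hq0 : 0 < q := div_pos (by linarith) hvu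
  have hpq : p + q = 1 := by rw [hp, hq]; field_simp; ring
  have hσpq : σ = p * u + q * v := by rw [hp, hq]; field_simp; ring
  have hle : ∑' x, ‖c x‖ * Real.exp ((x - y) * σ) ≤
      p * (∑' x, ‖c x‖ * Real.exp ((x - y) * u)) + q * ∑' x, ‖c x‖ * Real.exp ((x - y) * v) := by
    rw [← tsum_mul_left, ← tsum_mul_left,
      ← ((hsum u hu).mul_left p).tsum_add ((hsum v hv).mul_left q)]
    refine (hsum σ hσ).tsum_le_tsum (fun x => ?_)
      (((hsum u hu).mul_left p).add ((hsum v hv).mul_left q))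
    have h3 := convexOn_exp.2 (Set.mem_univ ((x - y) * u)) (Set.mem_univ ((x - y) * v))
      hp0.le hq0.le hpq
    simp only [smul_eq_mul] at h3
    rw [show p * ((x - y) * u) + q * ((x - y) * v) = (x - y) * σ by rw [hσpq]; ring] at h3
    have := mul_le_mul_of_nonneg_left h3 (norm_nonneg (c x))
    linarith
  refine hle.trans_lt ?_
  calc _ < p * (2 * ‖c y‖) + q * (2 * ‖c y‖) := by gcongr
    _ = 2 * ‖c y‖ := by rw [← add_mul, hpq, one_mul]

/-- If points where some term dominates accumulate at `σ`, then a single term does so, and it weakly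
dominates at `σ`. -/
lemma exists_dominant_of_frequently
    (hs : ∀ σ ∈ realInterval α β, Summable fun x => ‖c x‖ * Real.exp (x * σ))
    (hc : ∃ x, c x ≠ 0) {σ : ℝ} (hσ : σ ∈ realInterval α β) {l : Filter ℝ} (hl : l ≤ 𝓝 σ)
    (hfr : ∃ᶠ w in l, ∃ y, ∑' x, ‖c x‖ * Real.exp (x * w) < 2 * (‖c y‖ * Real.exp (y * w))) :
    ∃ y, ∑' x, ‖c x‖ * Real.exp (x * σ) ≤ 2 * (‖c y‖ * Real.exp (y * σ)) ∧
      ∃ᶠ w in l, w ∈ realInterval α β ∧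
        ∑' x, ‖c x‖ * Real.exp (x * w) < 2 * (‖c y‖ * Real.exp (y * w)) := by
  set Tot : ℝ → ℝ := fun w => ∑' x, ‖c x‖ * Real.exp (x * w) with hTot
  have hcont : ContinuousAt Tot σ :=
    (continuousOn_tsum_norm_exp hs).continuousAt ((isOpen_realInterval α β).mem_nhds hσ)
  have hpos : 0 < Tot σ := by
    obtain ⟨x, hx⟩ := hc
    exact (hs σ hσ).tsum_pos (fun x => by positivity) x
      (mul_pos (norm_pos_iff.2 hx) (Real.exp_pos _))
  obtain ⟨δ, hδ, hsub⟩ := exists_Ioo_subset_realInterval hσ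
  have hu : Summable fun x => ‖c x‖ * Real.exp (x * (σ - δ)) + ‖c x‖ * Real.exp (x * (σ + δ)) :=
    (hs _ (hsub ⟨le_rfl, by linarith⟩)).add (hs _ (hsub ⟨by linarith, le_rfl⟩))
  -- Near `σ` the total exceeds `Tot σ / 2`, so a dominant term exceeds `Tot σ / 4`. Only finitely
  -- many terms can, hence one of them dominates frequently.
  have hfin : {y | Tot σ / 4 ≤
      ‖c y‖ * Real.exp (y * (σ - δ)) + ‖c y‖ * Real.exp (y * (σ + δ))}.Finite := by
    have := hu.tendsto_cofinite_zero.eventually (gt_mem_nhds (show 0 < Tot σ / 4 by positivity))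
    rw [eventually_cofinite] at this
    simpa using this
  have hev : ∀ᶠ w in l, w ∈ Set.Icc (σ - δ) (σ + δ) ∧ Tot σ / 2 < Tot w :=
    hl ((show ∀ᶠ w in 𝓝 σ, w ∈ Set.Icc (σ - δ) (σ + δ) from
      Icc_mem_nhds (by linarith) (by linarith)).and (hcont.eventually (lt_mem_nhds (by linarith))))
  obtain ⟨y, -, hy⟩ : ∃ y ∈ {y | Tot σ / 4 ≤
      ‖c y‖ * Real.exp (y * (σ - δ)) + ‖c y‖ * Real.exp (y * (σ + δ))},
      ∃ᶠ w in l, w ∈ realInterval α β ∧ Tot w < 2 * (‖c y‖ * Real.exp (y * w)) := by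
    by_contra! hcon
    have hall := (eventually_all_finite hfin).2 hcon
    refine hfr ?_
    filter_upwards [hall, hev] with w hw ⟨hwI, hwT⟩
    rintro ⟨y, hy⟩
    change Tot w < _ at hy
    refine absurd (hw y ?_ (hsub hwI)) (not_le.2 hy)
    have h1 : ‖c y‖ * Real.exp (y * w) ≤
        ‖c y‖ * Real.exp (y * (σ - δ)) + ‖c y‖ * Real.exp (y * (σ + δ)) := by
      rw [← mul_add]
      gcongr
      exact exp_mul_le_add_exp hwI.1 hwI.2
    linarith
  refine ⟨y, ?_, hy⟩
  by_contra! hlt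
  have hev2 : ∀ᶠ w in l, 2 * (‖c y‖ * Real.exp (y * w)) < Tot w := by
    have h1 : ContinuousAt (fun w => Tot w - 2 * (‖c y‖ * Real.exp (y * w))) σ :=
      hcont.sub (by fun_prop)
    filter_upwards [hl (h1.eventually (lt_mem_nhds (sub_pos.2 hlt)))] with w hw
    exact sub_pos.1 hw
  obtain ⟨w, h1, h2⟩ := (hy.and_eventually hev2).exists
  exact absurd h1.2 (not_lt.2 h2.le)

/-- Near an abscissa at which no term dominates there is a whole one-sided neighbourhood of such
abscissas, provided the series has at least three terms. -/
lemma eventually_or_eventually_not_dominant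
    (hs : ∀ σ ∈ realInterval α β, Summable fun x => ‖c x‖ * Real.exp (x * σ))
    (hcard : 3 ≤ {x | c x ≠ 0}.encard) {σ : ℝ} (hσ : σ ∈ realInterval α β)
    (hdom : ∀ y, 2 * (‖c y‖ * Real.exp (y * σ)) ≤ ∑' x, ‖c x‖ * Real.exp (x * σ)) :
    (∀ᶠ w in 𝓝[>] σ, ∀ y, 2 * (‖c y‖ * Real.exp (y * w)) ≤ ∑' x, ‖c x‖ * Real.exp (x * w)) ∨
    ∀ᶠ w in 𝓝[<] σ, ∀ y, 2 * (‖c y‖ * Real.exp (y * w)) ≤ ∑' x, ‖c x‖ * Real.exp (x * w) := by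
  classical
  have hthird : ∀ a b : ℝ, ∃ k, k ≠ a ∧ k ≠ b ∧ c k ≠ 0 := by
    intro a b
    by_contra! hcon
    have hsub : {x | c x ≠ 0} ⊆ {a, b} := by
      intro x hx
      by_contra hx'
      simp only [Set.mem_insert_iff, Set.mem_singleton_iff, not_or] at hx'
      exact hx (hcon x hx'.1 hx'.2)
    have h1 := (hcard.trans (Set.encard_le_encard hsub)).trans ((Set.encard_insert_le {b} a).trans_eq
      (by rw [Set.encard_singleton, one_add_one_eq_two]))
    exact absurd h1 (by decide)
  have hc : ∃ x, c x ≠ 0 := by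
    obtain ⟨k, -, -, hk⟩ := hthird 0 0
    exact ⟨k, hk⟩
  by_contra! hcon
  obtain ⟨a, ha, hfa⟩ := exists_dominant_of_frequently hs hc hσ nhdsWithin_le_nhds hcon.1
  obtain ⟨b, hb, hfb⟩ := exists_dominant_of_frequently hs hc hσ nhdsWithin_le_nhds hcon.2
  -- Term `a` dominates at points to the right arbitrarily near `σ`, and `b` at points to the left.
  -- If they agree, convexity makes the term dominate at `σ`. If not, each is at least half of the
  -- total there, which leaves no room for a third nonzero term.
  by_cases hab : a = b
  · subst hab
    obtain ⟨v, ⟨hv, hv1⟩, hv2⟩ := (hfa.and_eventually self_mem_nhdsWithin).exists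
    obtain ⟨u, ⟨hu, hu1⟩, hu2⟩ := (hfb.and_eventually self_mem_nhdsWithin).exists
    exact absurd (tsum_lt_two_mul_of_between hs hu hv hu2 hv2 hu1 hv1) (not_lt.2 (hdom a))
  · obtain ⟨k, hka, hkb, hk⟩ := hthird a b
    have h1 := (hs σ hσ).sum_le_tsum {a, b, k} fun x _ => by positivity
    rw [Finset.sum_insert (by simp [hab, hka.symm]), Finset.sum_insert (by simp [hkb.symm]),
      Finset.sum_singleton] at h1
    have h2 : 0 < ‖c k‖ * Real.exp (k * σ) := mul_pos (norm_pos_iff.2 hk) (Real.exp_pos _)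
    linarith

end Dominance

/-! ### Decomposition into intervals, accumulation, and the theorem. -/

/-- If every point of `R` has a one-sided neighbourhood in `R`, then `R` is a disjoint union of
countably many nondegenerate intervals. -/
lemma exists_countable_intervals {R : Set ℝ} (hR : ∀ x ∈ R, ∃ y, y ≠ x ∧ Set.uIcc x y ⊆ R) :
    ∃ C : Set (Set ℝ), C.Countable ∧ C.PairwiseDisjoint id ∧
      (∀ J ∈ C, J.OrdConnected ∧ J.Nontrivial) ∧ R = ⋃₀ C := by
  have hdisj : (Set.ordConnectedComponent R '' R).PairwiseDisjoint id := by
    rintro _ ⟨x, hx, rfl⟩ _ ⟨y, hy, rfl⟩ hne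
    refine Set.disjoint_left.2 fun z hzx hzy => hne ?_
    exact Set.ordConnectedComponent_eq
      (Set.mem_ordConnectedComponent_trans hzx (Set.mem_ordConnectedComponent_comm.1 hzy))
  have hsub : ∀ x y : ℝ, Set.uIcc x y ⊆ R → Set.uIcc x y ⊆ Set.ordConnectedComponent R x :=
    fun x y h => Set.subset_ordConnectedComponent Set.left_mem_uIcc h
  refine ⟨Set.ordConnectedComponent R '' R, ?_, hdisj, ?_, ?_⟩
  -- The order components are disjoint and each contains an open interval, so separability of `ℝ`
  -- makes them countably many.
  · refine hdisj.countable_of_nonempty_interior ?_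
    rintro _ ⟨x, hx, rfl⟩
    obtain ⟨y, hy, h⟩ := hR x hx
    have h1 : Set.Ioo (min x y) (max x y) ⊆ interior (Set.ordConnectedComponent R x) :=
      interior_maximal (Set.Ioo_subset_Icc_self.trans (hsub x y h)) isOpen_Ioo
    exact (Set.nonempty_Ioo.2 (min_lt_max.2 hy.symm)).mono h1
  · rintro _ ⟨x, hx, rfl⟩
    obtain ⟨y, hy, h⟩ := hR x hx
    exact ⟨inferInstance, x, hsub x y h Set.left_mem_uIcc, y, hsub x y h Set.right_mem_uIcc,
      hy.symm⟩
  · ext x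
    constructor
    · intro hx
      exact ⟨_, ⟨x, hx, rfl⟩, Set.self_mem_ordConnectedComponent.2 hx⟩
    · rintro ⟨_, ⟨y, -, rfl⟩, hx⟩
      exact Set.ordConnectedComponent_subset hx

lemma exists_uIcc_subset_of_eventually {R : Set ℝ} {σ : ℝ} (hσ : σ ∈ R)
    (h : (∀ᶠ w in 𝓝[>] σ, w ∈ R) ∨ ∀ᶠ w in 𝓝[<] σ, w ∈ R) :
    ∃ y, y ≠ σ ∧ Set.uIcc σ y ⊆ R := by
  rcases h with h | h
  · obtain ⟨u, hu, hsub⟩ := mem_nhdsGT_iff_exists_Ioo_subset.1 h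
    have hu' : σ < u := hu
    refine ⟨(σ + u) / 2, by linarith, ?_⟩
    rw [Set.uIcc_of_le (by linarith)]
    intro w hw
    rcases hw.1.eq_or_lt with rfl | hlt
    · exact hσ
    · exact hsub ⟨hlt, by linarith [hw.2]⟩
  · obtain ⟨u, hu, hsub⟩ := mem_nhdsLT_iff_exists_Ioo_subset.1 h
    have hu' : u < σ := hu
    refine ⟨(σ + u) / 2, by linarith, ?_⟩
    rw [Set.uIcc_of_ge (by linarith)]
    intro w hw
    rcases hw.2.eq_or_lt with rfl | hlt
    · exact hσ
    · exact hsub ⟨by linarith [hw.1], hlt⟩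

/-- The segment supplies points `w ≠ σ` of the closure arbitrarily near `σ`. A neighbourhood of `w`
that avoids `σ` still meets `Z`, so an interval in the closure produces accumulation of `Z` itself.
-/
lemma accPt_of_uIcc_subset_closure {Z : Set ℝ} {σ y : ℝ} (hy : y ≠ σ)
    (h : Set.uIcc σ y ⊆ closure Z) : AccPt σ (𝓟 Z) := by
  rw [accPt_iff_nhds]
  intro U hU
  obtain ⟨V, hVU, hVo, hσV⟩ := mem_nhds_iff.1 hU
  have h1 : ∀ᶠ n : ℕ in atTop, σ + (y - σ) * (1 / ((n : ℝ) + 1)) ∈ V := by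
    have h2 : Tendsto (fun n : ℕ => σ + (y - σ) * (1 / ((n : ℝ) + 1))) atTop
        (𝓝 (σ + (y - σ) * 0)) :=
      (tendsto_one_div_add_atTop_nhds_zero_nat.const_mul (y - σ)).const_add σ
    rw [mul_zero, add_zero] at h2
    exact h2 (hVo.mem_nhds hσV)
  obtain ⟨n, hn⟩ := h1.exists
  set r : ℝ := 1 / ((n : ℝ) + 1) with hr
  have hr0 : 0 < r := by positivity
  have hr1 : r ≤ 1 := by
    rw [hr, div_le_one (by positivity)]
    linarith [Nat.cast_nonneg (α := ℝ) n]
  set w := σ + (y - σ) * r with hw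
  have hwσ : w ≠ σ := by
    rw [hw]; intro h'
    have : (y - σ) * r = 0 := by linarith
    rcases mul_eq_zero.1 this with h3 | h3
    · exact hy (sub_eq_zero.1 h3)
    · exact hr0.ne' h3
  have hwI : w ∈ Set.uIcc σ y := by
    rcases le_total σ y with hle | hle
    · rw [Set.uIcc_of_le hle]; constructor <;> nlinarith
    · rw [Set.uIcc_of_ge hle]; constructor <;> nlinarith
  obtain ⟨p, hp, hpZ⟩ := mem_closure_iff.1 (h hwI) (V ∩ {σ}ᶜ)
    (hVo.inter isClosed_singleton.isOpen_compl) ⟨hn, hwσ⟩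
  exact ⟨p, ⟨hVU hp.1, hpZ⟩, hp.2⟩

theorem mainTheorem1 (f : ℂ → ℂ) (α β : EReal) (hαβ : α < β)
    (hf : IsAlmostPeriodicInStrip f α β)
    (hcard : 3 ≤ (fourierExponents f α β).encard)
    (hindep : LinearIndependent ℚ (fun lam : fourierExponents f α β => (lam : ℝ))) :
    (∀ σ ∈ zeroRealParts f α β, AccPt σ (𝓟 (zeroRealParts f α β))) ∧
      ∃ C : Set (Set ℝ), C.Countable ∧ C.PairwiseDisjoint id ∧
        (∀ J ∈ C, J.OrdConnected ∧ J.Nontrivial) ∧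
        closedZeroRealParts f α β = ⋃₀ C := by
  obtain ⟨c, hc, hs, hfc⟩ := hf.exists_dirichlet_series hαβ hindep
  rw [← hc] at hcard hindep
  have hne : ∃ x, c x ≠ 0 := by
    by_contra! h
    have : {x | c x ≠ 0} = ∅ := by ext x; simp [h]
    rw [this] at hcard
    simp at hcard
  have hiff := fun {σ : ℝ} (hσ : σ ∈ realInterval α β) =>
    mem_closedZeroRealParts_iff hne hindep hs hfc hσ
  have hR : ∀ σ ∈ closedZeroRealParts f α β, ∃ y, y ≠ σ ∧ Set.uIcc σ y ⊆
      closedZeroRealParts f α β := by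
    intro σ hσ
    refine exists_uIcc_subset_of_eventually hσ ?_
    have hmem : ∀ᶠ w in 𝓝 σ, w ∈ realInterval α β := (isOpen_realInterval α β).mem_nhds hσ.2
    refine (eventually_or_eventually_not_dominant hs hcard hσ.2 ((hiff hσ.2).1 hσ)).imp
      (fun h => ?_) (fun h => ?_)
    · filter_upwards [h, nhdsWithin_le_nhds hmem] with w h1 h2 using (hiff h2).2 h1
    · filter_upwards [h, nhdsWithin_le_nhds hmem] with w h1 h2 using (hiff h2).2 h1
  refine ⟨fun σ hσ => ?_, exists_countable_intervals hR⟩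
  have hσR : σ ∈ closedZeroRealParts f α β := by
    refine ⟨subset_closure hσ, ?_⟩
    obtain ⟨s, ⟨hsU, -⟩, rfl⟩ := hσ
    exact hsU
  obtain ⟨y, hy, hsub⟩ := hR σ hσR
  exact accPt_of_uIcc_subset_closure hy (hsub.trans Set.inter_subset_left)
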